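/- Let $M\subset\mathbb R^3$ be a closed (compact, without boundary) smooth embedded surface with area measure $da$, given in a local parametrization $S:U\subset\mathbb R^2\to M$ with Jacobian $J$ and $g=J^TJ$ by $\sqrt{\det g}\,d\omega_1d\omega_2$; write $|A|=\int_A da$, and let $\nabla_g\cdot$ be the divergence of tangent vector fields on $M$. For $u\in L^2(M)$ put $$NETV(u)=\sup_z\int_M u\,\nabla_g\cdot z\,da\in[0,\infty],$$ the supremum over continuously differentiable tangent vector fields $z$ on $M$ with $\|z\|\le 1$, and for $C\subset M$ put $NETV(C)=NETV(\chi^C)$. Let $$\partial NETV(u)=\Big\{p\in L^2(M): NETV(v)\ge\int_M p\,v\,da\ \ \forall v\in L^2(M),\quad NETV(u)=\int_M p\,u\,da\Big\}.$$ A function $u\in L^2(M)$ is an eigenfunction of $NETV$ with eigenvalue $\lambda\in\mathbb R$ if $\lambda u\in\partial NETV(u)$ and $\nabla_g\cdot\xi=\lambda u$ in the weak sense for some integrable tangent vector field $\xi$ on $M$. A set $C\subset M$ is an eigenset with eigenvalue $\lambda$ if for some $\beta>0$ the function $\psi=\chi^C-\beta\chi^{M\setminus C}$ is an eigenfunction of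 $NETV$ with eigenvalue $\lambda$. Let $C\subset M$ be a nonempty set with smooth boundary $\partial C$ relative to $M$ (near each boundary point, in a suitable local parametrization of $M$, $C$ is a half plane, up to points of $\partial C$), and let $\partial C$ be parametrized by finitely many continuously differentiable curves $\gamma_i:[a_i,b_i]\to\mathbb R^3$ whose restrictions to the intervals $[a_i,b_i)$ pass through each point of $\partial C$ exactly once altogether and through no other point (no curves if $\partial C=\emptyset$). Put $per(C)=\sum_i\int_{a_i}^{b_i}\|\gamma_i'(t)\|\,dt$. If $C$ is an eigenset with eigenvalue $\lambda$, then $$\lambda\,|C|=NETV(C)=per(C).$$ In particular $|C|>0$ and $\lambda=per(C)/|C|$, so the eigenvalue is the ratio of perimeter to area. -/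

import Mathlib

open MeasureTheory
open scoped ContDiff

noncomputable section

/-- Local parametrizations of a set `M ⊆ ℝ³`: a smooth injective immersion `S` of an open set
`U ⊆ ℝ²` into `M` which is a homeomorphism onto a relatively open subset of `M`. -/
structure LocalParam (M : Set (EuclideanSpace ℝ (Fin 3))) where
  U : Set (EuclideanSpace ℝ (Fin 2))
  S : EuclideanSpace ℝ (Fin 2) → EuclideanSpace ℝ (Fin 3)
  isOpen_U : IsOpen U
  contDiffOn : ContDiffOn ℝ ∞ S U
  injOn : Set.InjOn S U
  injective_fderiv : ∀ x ∈ U, Function.Injective (fderiv ℝ S x)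
  /-- Open subsets of `U` are mapped onto relatively open subsets of `M`. -/
  image_open : ∀ W ⊆ U, IsOpen W → ∃ O, IsOpen O ∧ S '' W = M ∩ O

namespace LocalParam

variable {M : Set (EuclideanSpace ℝ (Fin 3))}

/-- The first fundamental form `g = Jᵀ J`. -/
def metric (P : LocalParam M) (x : EuclideanSpace ℝ (Fin 2)) : Matrix (Fin 2) (Fin 2) ℝ :=
  Matrix.of fun i j =>
    inner ℝ (fderiv ℝ P.S x (EuclideanSpace.single i 1)) (fderiv ℝ P.S x (EuclideanSpace.single j 1))

/-- The area of the patch `S(U)`: the image under `S` of `√(det g) dω₁ dω₂` on `U`. -/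
def patchArea (P : LocalParam M) : Measure (EuclideanSpace ℝ (Fin 3)) :=
  ((volume.restrict P.U).withDensity
    fun x => ENNReal.ofReal (Real.sqrt (P.metric x).det)).map P.S

end LocalParam

/-- A closed smooth surface in `ℝ³`: compact, and without boundary since every point lies in a
patch parametrized by an open subset of the plane. -/
structure IsClosedSurface (M : Set (EuclideanSpace ℝ (Fin 3))) : Prop where
  isCompact : IsCompact M
  exists_param : ∀ p ∈ M, ∃ P : LocalParam M, p ∈ P.S '' P.U

/-- The area measure of `M`. The measures `√(det g) dω₁ dω₂` of the patches agree on overlaps, so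
their least upper bound is the measure on `M` obtained by gluing them. -/
def areaMeasure (M : Set (EuclideanSpace ℝ (Fin 3))) : Measure (EuclideanSpace ℝ (Fin 3)) :=
  ⨆ P : LocalParam M, P.patchArea

/-- The tangent plane `T_q M`, spanned by the partial derivatives of a local parametrization
(the plane does not depend on the parametrization). -/
def tangentPlane (M : Set (EuclideanSpace ℝ (Fin 3))) (q : EuclideanSpace ℝ (Fin 3)) :
    Submodule ℝ (EuclideanSpace ℝ (Fin 3)) :=
  ⨆ (P : LocalParam M) (x : EuclideanSpace ℝ (Fin 2)) (_ : x ∈ P.U ∧ P.S x = q),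
    LinearMap.range (fderiv ℝ P.S x).toLinearMap

/-- The divergence on `M` of a tangent field `Z`, the trace on `T_q M` of its covariant derivative
(the tangential part of its derivative); in coordinates, `(1/√|g|) ∑ᵢ ∂ᵢ(√|g| zⁱ)`. -/
def surfaceDiv (M : Set (EuclideanSpace ℝ (Fin 3)))
    (Z : EuclideanSpace ℝ (Fin 3) → EuclideanSpace ℝ (Fin 3)) (q : EuclideanSpace ℝ (Fin 3)) : ℝ :=
  LinearMap.trace ℝ (EuclideanSpace ℝ (Fin 3))
    ((tangentPlane M q).starProjection ∘L fderiv ℝ Z q).toLinearMap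

/-- Continuously differentiable tangent fields on `M` of norm at most one (every such field on a
closed surface is the restriction of a continuously differentiable map on `ℝ³`). -/
structure IsTestField (M : Set (EuclideanSpace ℝ (Fin 3)))
    (Z : EuclideanSpace ℝ (Fin 3) → EuclideanSpace ℝ (Fin 3)) : Prop where
  contDiff : ContDiff ℝ 1 Z
  tangent : ∀ q ∈ M, Z q ∈ tangentPlane M q
  norm_le_one : ∀ q ∈ M, ‖Z q‖ ≤ 1

/-- The (non-Euclidean) total variation on `M`. -/
def NETV (M : Set (EuclideanSpace ℝ (Fin 3))) (u : EuclideanSpace ℝ (Fin 3) → ℝ) : EReal :=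
  ⨆ (Z : EuclideanSpace ℝ (Fin 3) → EuclideanSpace ℝ (Fin 3)) (_ : IsTestField M Z),
    ((∫ q, u q * surfaceDiv M Z q ∂(areaMeasure M) : ℝ) : EReal)

/-- The subdifferential of the total variation at `u`, in `L²(M)`. -/
def subdiffNETV (M : Set (EuclideanSpace ℝ (Fin 3))) (u : EuclideanSpace ℝ (Fin 3) → ℝ) :
    Set (EuclideanSpace ℝ (Fin 3) → ℝ) :=
  {p | MemLp p 2 (areaMeasure M) ∧
    (∀ v : EuclideanSpace ℝ (Fin 3) → ℝ, MemLp v 2 (areaMeasure M) →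
      ((∫ q, p q * v q ∂(areaMeasure M) : ℝ) : EReal) ≤ NETV M v) ∧
    NETV M u = ((∫ q, p q * u q ∂(areaMeasure M) : ℝ) : EReal)}

/-- `f` is the divergence on `M` of the integrable tangent field `ξ` in the weak sense, that is,
in the sense of the adjoint of the gradient: `∫ f φ da = -∫ ⟨ξ, ∇φ⟩ da` for smooth `φ`. -/
structure IsWeakDiv (M : Set (EuclideanSpace ℝ (Fin 3)))
    (ξ : EuclideanSpace ℝ (Fin 3) → EuclideanSpace ℝ (Fin 3))
    (f : EuclideanSpace ℝ (Fin 3) → ℝ) : Prop where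
  integrable_field : Integrable ξ (areaMeasure M)
  tangent : ∀ᵐ q ∂(areaMeasure M), ξ q ∈ tangentPlane M q
  integrable_div : Integrable f (areaMeasure M)
  integral_eq : ∀ φ : EuclideanSpace ℝ (Fin 3) → ℝ, ContDiff ℝ ∞ φ →
    ∫ q, f q * φ q ∂(areaMeasure M) = -∫ q, fderiv ℝ φ q (ξ q) ∂(areaMeasure M)

/-- `u ∈ L²(M)` is an eigenfunction of the total variation with eigenvalue `lam`. -/
def IsEigenfunction (M : Set (EuclideanSpace ℝ (Fin 3))) (lam : ℝ)
    (u : EuclideanSpace ℝ (Fin 3) → ℝ) : Prop :=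
  MemLp u 2 (areaMeasure M) ∧
  ∃ ξ : EuclideanSpace ℝ (Fin 3) → EuclideanSpace ℝ (Fin 3),
    (fun q => lam * u q) ∈ subdiffNETV M u ∧ IsWeakDiv M ξ (fun q => lam * u q)

/-- `C` is an eigenset with eigenvalue `lam`: for some `β > 0` the function equal to `1` on `C` and
to `-β` on `M \ C` is an eigenfunction with eigenvalue `lam`. -/
def IsEigenset (M C : Set (EuclideanSpace ℝ (Fin 3))) (lam : ℝ) : Prop :=
  ∃ β : ℝ, 0 < β ∧
    IsEigenfunction M lam (fun q => C.indicator 1 q - β * (M \ C).indicator 1 q)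

/-- The boundary of `C` relative to the (closed) set `M`. -/
def relBoundary (M C : Set (EuclideanSpace ℝ (Fin 3))) : Set (EuclideanSpace ℝ (Fin 3)) :=
  closure C ∩ closure (M \ C)

/-- `C ⊆ M` has smooth boundary: near each boundary point there is a local parametrization of `M`
in which `C` is a half plane. No condition is put on which boundary points belong to `C`. -/
def HasSmoothBoundary (M C : Set (EuclideanSpace ℝ (Fin 3))) : Prop :=
  ∀ p ∈ relBoundary M C, ∃ P : LocalParam M, p ∈ P.S '' P.U ∧
    ∀ x ∈ P.U, (0 < x 1 → P.S x ∈ C) ∧ (x 1 < 0 → P.S x ∉ C)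

/-- A parametrization of the boundary of `C` in `M` by finitely many continuously differentiable
curves `γ i` on `[a i, b i)`, passing exactly once through every boundary point. -/
structure BoundaryParam (M C : Set (EuclideanSpace ℝ (Fin 3))) where
  n : ℕ
  a : Fin n → ℝ
  b : Fin n → ℝ
  lt : ∀ i, a i < b i
  γ : Fin n → ℝ → EuclideanSpace ℝ (Fin 3)
  contDiffOn : ∀ i, ContDiffOn ℝ 1 (γ i) (Set.Icc (a i) (b i))
  bijOn : Set.BijOn (fun s : (_ : Fin n) × ℝ => γ s.1 s.2)
    {s | s.2 ∈ Set.Ico (a s.1) (b s.1)} (relBoundary M C)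

/-- The perimeter: the total length of the boundary curves. -/
def BoundaryParam.per {M C : Set (EuclideanSpace ℝ (Fin 3))} (Γ : BoundaryParam M C) : ℝ :=
  ∑ i, ∫ t in Γ.a i..Γ.b i, ‖deriv (Γ.γ i) t‖

end

/-!
Let `ν` be the inner conormal of `∂C`: the unit tangent vector of `M` at a boundary point which is
orthogonal to `∂C` and points into `C`. The theorem rests on the Gauss–Green formula
`∫_C div Z da = -∫_{∂C} ⟨Z, ν⟩ ds` for `C¹` tangent fields `Z`. It bounds the left side by the
length of `∂C` whenever `‖Z‖ ≤ 1`, and the bound is attained by a field with `Z = -ν` on `∂C`; hence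
`NETV(C) = per(C)` (`AdaptedPartition.integral_le_per`, `AdaptedPartition.integral_outerConormal`).
For `C = M` there is no boundary, and the formula is the divergence theorem
(`IsClosedSurface.integral_surfaceDiv`), so adding a constant to a function does not change its
total variation.

Now let `ψ = χ^C - β χ^{M∖C}` be the eigenfunction. On `M` it is `(1 + β) χ^C - β`, so
`NETV(ψ) = (1 + β) per(C)`. On the other hand `NETV(ψ) = ∫ λψ ψ`, and `∫ λψ = 0` because `λψ` is a
weak divergence, so this is `(1 + β) ∫ λψ χ^C = (1 + β) λ |C|`. Comparing gives `λ |C| = per(C)`.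

The Gauss–Green formula is proved without boundary measure, by a finite partition of unity
subordinate to parametrizations in which `C` is the half plane `{x₁ > 0}`
(`LocalParam.exists_isAdapted`). In such a parametrization `√g div Z = ∂₀(√g z⁰) + ∂₁(√g z¹)`
(`LocalParam.sqrt_gram_mul_surfaceDiv`), the divergence theorem in the half plane leaves
`-∫ √g z¹ ds` along `{x₁ = 0}`, and `√g z¹ = ⟨Z, ν⟩ ‖∂₀S‖`. The line integrals
`∫ f ‖∂₀S‖ ds` are the integrals of `f` along the given boundary curves by the one-dimensional
change of variables (`BoundaryParam.integral_line_eq_sum`). That the area measure, a supremum over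
all parametrizations, is given on each patch by that patch alone is the two-dimensional change of
variables (`LocalParam.restrict_areaMeasure`). Inverses of parametrizations are always restrictions
of `C¹` maps on open subsets of the ambient space (`LocalParam.exists_isLocalInverse`), which also
makes the glued conormals a test field.
-/

noncomputable section

open Set Topology

/-! ### Frames of a plane in an inner product space -/

section Gram

variable {V : Type*} [NormedAddCommGroup V] [InnerProductSpace ℝ V]

/-- The Gram determinant `⟨a, a⟩⟨b, b⟩ - ⟨a, b⟩²` of two vectors. -/
def gramDet (a b : V) : ℝ := inner ℝ a a * inner ℝ b b - inner ℝ a b ^ 2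

/-- The coefficient of `a` in the orthogonal projection of `v` to the plane spanned by `a` and `b`.
The coefficient of `b` is `gramCoord b a v`. -/
def gramCoord (a b v : V) : ℝ :=
  (inner ℝ b b * inner ℝ a v - inner ℝ a b * inner ℝ b v) / gramDet a b

/-- The unit vector of the plane spanned by `a` and `b` which is orthogonal to `a` and lies on the
same side of the line `ℝ a` as `b`. -/
def gramNormal (a b : V) : V :=
  (‖a‖ / √(gramDet a b)) • (b - (inner ℝ a b / inner ℝ a a) • a)

theorem gramDet_comm (a b : V) : gramDet b a = gramDet a b := by
  simp only [gramDet, real_inner_comm a b]; ring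

theorem gramDet_pos {a b : V} (h : LinearIndependent ℝ ![a, b]) : 0 < gramDet a b := by
  have ha : a ≠ 0 := by simpa using h.ne_zero 0
  have hne : (-inner ℝ a b) • a + (inner ℝ a a) • b ≠ 0 := by
    intro h0
    have := (LinearIndependent.pair_iff.1 h _ _ h0).2
    exact ha (inner_self_eq_zero.1 this)
  have h1 : 0 < inner ℝ ((-inner ℝ a b) • a + (inner ℝ a a) • b)
      ((-inner ℝ a b) • a + (inner ℝ a a) • b) := real_inner_self_pos.2 hne
  have h2 : inner ℝ ((-inner ℝ a b) • a + (inner ℝ a a) • b)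
      ((-inner ℝ a b) • a + (inner ℝ a a) • b) = inner ℝ a a * gramDet a b := by
    simp only [inner_add_left, inner_add_right, real_inner_smul_left, real_inner_smul_right,
      gramDet, real_inner_comm a b]
    ring
  rw [h2] at h1
  exact (pos_iff_pos_of_mul_pos h1).1 (real_inner_self_pos.2 ha)

theorem gramCoord_add (a b v w : V) :
    gramCoord a b (v + w) = gramCoord a b v + gramCoord a b w := by
  simp only [gramCoord, inner_add_right]; ring

theorem gramCoord_smul (a b : V) (c : ℝ) (v : V) :
    gramCoord a b (c • v) = c * gramCoord a b v := by
  simp only [gramCoord, real_inner_smul_right]; ring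

theorem gramCoord_left {a b : V} (h : 0 < gramDet a b) : gramCoord a b a = 1 := by
  rw [gramCoord, div_eq_one_iff_eq h.ne', gramDet, real_inner_comm a b]; ring

theorem gramCoord_right (a b : V) : gramCoord a b b = 0 := by
  rw [gramCoord]; simp [mul_comm]

/-- `gramCoord a b` as a linear form. -/
def gramCoordₗ (a b : V) : V →ₗ[ℝ] ℝ where
  toFun := gramCoord a b
  map_add' := gramCoord_add a b
  map_smul' := gramCoord_smul a b

theorem starProjection_span_pair {a b : V} (h : 0 < gramDet a b) (T : Submodule ℝ V)
    [T.HasOrthogonalProjection] (hT : T = Submodule.span ℝ {a, b}) (v : V) :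
    T.starProjection v = gramCoord a b v • a + gramCoord b a v • b := by
  have hD : gramDet a b ≠ 0 := h.ne'
  apply Submodule.eq_starProjection_of_mem_of_inner_eq_zero
  · rw [hT, Submodule.mem_span_pair]
    exact ⟨_, _, rfl⟩
  · intro w hw
    rw [hT, Submodule.mem_span_pair] at hw
    obtain ⟨s, t, rfl⟩ := hw
    simp only [inner_sub_left, inner_add_left, inner_add_right, real_inner_smul_left,
      real_inner_smul_right, gramCoord, gramDet_comm a b, real_inner_comm a b,
      real_inner_comm a v, real_inner_comm b v]
    field_simp
    simp only [gramDet]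
    ring

theorem mem_span_pair_eq {a b : V} (h : 0 < gramDet a b) {v : V}
    (hv : v ∈ Submodule.span ℝ {a, b}) : v = gramCoord a b v • a + gramCoord b a v • b := by
  obtain ⟨s, t, rfl⟩ := Submodule.mem_span_pair.1 hv
  rw [gramCoord_add, gramCoord_add, gramCoord_smul, gramCoord_smul, gramCoord_smul, gramCoord_smul,
    gramCoord_left h, gramCoord_left (by rwa [gramDet_comm]), gramCoord_right, gramCoord_right]
  simp

/-- The trace over the plane spanned by `a` and `b`, computed in the frame `a`, `b`. -/
theorem trace_starProjection_comp [FiniteDimensional ℝ V] {a b : V} (h : 0 < gramDet a b)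
    (T : Submodule ℝ V) (hT : T = Submodule.span ℝ {a, b}) (A : V →L[ℝ] V) :
    LinearMap.trace ℝ V (T.starProjection ∘L A).toLinearMap
      = gramCoord a b (A a) + gramCoord b a (A b) := by
  have : (T.starProjection ∘L A).toLinearMap =
      ((gramCoordₗ a b) ∘ₗ A.toLinearMap).smulRight a
        + ((gramCoordₗ b a) ∘ₗ A.toLinearMap).smulRight b := by
    ext v
    simp [starProjection_span_pair h T hT, gramCoordₗ]
  rw [this, map_add, LinearMap.trace_smulRight, LinearMap.trace_smulRight]
  rfl

/-- The flux through the line `ℝ a`: for `v = z a + w b`, the normal component times the length of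
`a` is `√D w`. -/
theorem norm_mul_inner_gramNormal {a b : V} (ha : a ≠ 0) (h : 0 < gramDet a b) (v : V) :
    inner ℝ v (gramNormal a b) * ‖a‖ = √(gramDet a b) * gramCoord b a v := by
  have hs : 0 < √(gramDet a b) := Real.sqrt_pos.2 h
  have hsq : √(gramDet a b) ^ 2 = gramDet a b := Real.sq_sqrt h.le
  have ha' : ‖a‖ ≠ 0 := norm_ne_zero_iff.2 ha
  simp only [gramNormal, gramCoord, real_inner_smul_right, inner_sub_right, gramDet_comm a b,
    real_inner_self_eq_norm_sq, real_inner_comm v, real_inner_comm a b]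
  field_simp
  rw [hsq]
  ring

theorem norm_gramNormal {a b : V} (ha : a ≠ 0) (h : 0 < gramDet a b) : ‖gramNormal a b‖ = 1 := by
  have hs : 0 < √(gramDet a b) := Real.sqrt_pos.2 h
  have hsq : √(gramDet a b) ^ 2 = gramDet a b := Real.sq_sqrt h.le
  have ha' : ‖a‖ ≠ 0 := norm_ne_zero_iff.2 ha
  rw [← sq_eq_sq₀ (norm_nonneg _) zero_le_one, ← real_inner_self_eq_norm_sq]
  simp only [gramNormal, real_inner_smul_right, real_inner_smul_left, inner_sub_right,
    inner_sub_left, real_inner_comm a b]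
  simp only [real_inner_self_eq_norm_sq]
  field_simp
  rw [hsq, gramDet]
  simp only [real_inner_self_eq_norm_sq]
  ring

theorem gramNormal_mem_span (a b : V) : gramNormal a b ∈ Submodule.span ℝ {a, b} := by
  refine Submodule.smul_mem _ _ (Submodule.sub_mem _ ?_ (Submodule.smul_mem _ _ ?_)) <;>
  exact Submodule.subset_span (by simp)

/-- The unit normal depends only on the line spanned by `a` and on the side on which `b` lies. -/
theorem gramNormal_change {a b : V} {c e d : ℝ} (ha : a ≠ 0) (hc : c ≠ 0) (hd : 0 < d) :
    gramNormal (c • a) (e • a + d • b) = gramNormal a b := by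
  have ha' : ‖a‖ ≠ 0 := norm_ne_zero_iff.2 ha
  have h1 : gramDet (c • a) (e • a + d • b) = (|c| * d) ^ 2 * gramDet a b := by
    simp only [gramDet, inner_add_left, inner_add_right, real_inner_smul_left,
      real_inner_smul_right, real_inner_comm a b, mul_pow, sq_abs]
    ring
  have h2 : (e • a + d • b) - (inner ℝ (c • a) (e • a + d • b) / inner ℝ (c • a) (c • a)) • c • a
      = d • (b - (inner ℝ a b / inner ℝ a a) • a) := by
    have : inner ℝ (c • a) (e • a + d • b) / inner ℝ (c • a) (c • a) * c
        = e + d * (inner ℝ a b / inner ℝ a a) := by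
      simp only [inner_add_right, real_inner_smul_left, real_inner_smul_right]
      simp only [real_inner_self_eq_norm_sq]
      field_simp
    rw [smul_smul, this, smul_sub, add_smul, smul_smul]
    abel
  have hc' : |c| ≠ 0 := abs_ne_zero.2 hc
  rw [gramNormal, h1, h2, Real.sqrt_mul (sq_nonneg _), Real.sqrt_sq (by positivity), norm_smul,
    smul_smul, gramNormal, Real.norm_eq_abs]
  congr 1
  by_cases h0 : √(gramDet a b) = 0
  · simp [h0]
  · field_simp

end Gram

section Divergence

variable {V : Type*} [NormedAddCommGroup V] [InnerProductSpace ℝ V]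
variable {W : Type*} [NormedAddCommGroup W] [NormedSpace ℝ W]

theorem hasFDerivAt_gramDet {a b : W → V} {a' b' : W →L[ℝ] V} {x : W} (ha : HasFDerivAt a a' x)
    (hb : HasFDerivAt b b' x) :
    ∃ D' : W →L[ℝ] ℝ, HasFDerivAt (fun y => gramDet (a y) (b y)) D' x ∧
      ∀ e, D' e = 2 * (inner ℝ (b x) (b x) * inner ℝ (a x) (a' e)
        + inner ℝ (a x) (a x) * inner ℝ (b x) (b' e)
        - inner ℝ (a x) (b x) * (inner ℝ (b x) (a' e) + inner ℝ (a x) (b' e))) := by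
  refine ⟨_, ((ha.inner ℝ ha).mul (hb.inner ℝ hb)).sub ((ha.inner ℝ hb).pow 2), fun e => ?_⟩
  simp only [sub_apply, add_apply, smul_apply, smul_eq_mul, fderivInnerCLM_apply,
    ContinuousLinearMap.comp_apply, ContinuousLinearMap.prod_apply, nsmul_eq_mul]
  rw [real_inner_comm (a x) (a' e), real_inner_comm (b x) (b' e), real_inner_comm (b x) (a' e)]
  push_cast
  ring

theorem differentiableAt_gramCoord {a b Y : W → V} {x : W} (ha : DifferentiableAt ℝ a x)
    (hb : DifferentiableAt ℝ b x) (hY : DifferentiableAt ℝ Y x) (h : 0 < gramDet (a x) (b x)) :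
    DifferentiableAt ℝ (fun y => gramCoord (a y) (b y) (Y y)) x := by
  simp only [gramCoord, div_eq_mul_inv]
  refine DifferentiableAt.fun_mul (𝔸 := ℝ) ?_ (DifferentiableAt.fun_inv ?_ h.ne')
  · exact ((hb.inner ℝ hb).mul (ha.inner ℝ hY)).sub ((ha.inner ℝ hb).mul (hb.inner ℝ hY))
  · exact (hasFDerivAt_gramDet ha.hasFDerivAt hb.hasFDerivAt).choose_spec.1.differentiableAt

/-- The coordinate formula for the divergence: if `a` and `b` are the partial derivatives of a
parametrization (whence the symmetry hypothesis) and `Y = z a + w b`, then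
`∂₀(√D z) + ∂₁(√D w) = √D div Y` with `D` the Gram determinant. -/
theorem fderiv_sqrt_gramDet_mul_gramCoord_add {a b Y : W → V} {x e₀ e₁ : W}
    (ha : DifferentiableAt ℝ a x) (hb : DifferentiableAt ℝ b x) (hY : DifferentiableAt ℝ Y x)
    (h : 0 < gramDet (a x) (b x)) (hsymm : fderiv ℝ a x e₁ = fderiv ℝ b x e₀)
    (hspan : ∀ᶠ y in 𝓝 x, 0 < gramDet (a y) (b y) ∧ Y y ∈ Submodule.span ℝ {a y, b y}) :
    fderiv ℝ (fun y => √(gramDet (a y) (b y)) * gramCoord (a y) (b y) (Y y)) x e₀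
      + fderiv ℝ (fun y => √(gramDet (a y) (b y)) * gramCoord (b y) (a y) (Y y)) x e₁
    = √(gramDet (a x) (b x)) * (gramCoord (a x) (b x) (fderiv ℝ Y x e₀)
      + gramCoord (b x) (a x) (fderiv ℝ Y x e₁)) := by
  have hz := differentiableAt_gramCoord ha hb hY h
  have hw := differentiableAt_gramCoord hb ha hY (by rwa [gramDet_comm])
  set z := fun y => gramCoord (a y) (b y) (Y y) with hzdef
  set w := fun y => gramCoord (b y) (a y) (Y y) with hwdef
  obtain ⟨D', hD, hD'⟩ := hasFDerivAt_gramDet ha.hasFDerivAt hb.hasFDerivAt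
  have hsD := hD.sqrt h.ne'
  have hYeq : Y =ᶠ[𝓝 x] fun y => z y • a y + w y • b y := by
    filter_upwards [hspan] with y hy using mem_span_pair_eq hy.1 hy.2
  have hYd : HasFDerivAt Y _ x :=
    ((hz.hasFDerivAt.smul ha.hasFDerivAt).add
      (hw.hasFDerivAt.smul hb.hasFDerivAt)).congr_of_eventuallyEq hYeq
  have e1 : fderiv ℝ (fun y => √(gramDet (a y) (b y)) * gramCoord (a y) (b y) (Y y)) x = _ :=
    (hsD.mul hz.hasFDerivAt).fderiv
  have e2 : fderiv ℝ (fun y => √(gramDet (a y) (b y)) * gramCoord (b y) (a y) (Y y)) x = _ :=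
    (hsD.mul hw.hasFDerivAt).fderiv
  rw [e1, e2, hYd.fderiv]
  have h' : 0 < gramDet (b x) (a x) := by rwa [gramDet_comm]
  simp only [add_apply, smul_apply,
    ContinuousLinearMap.smulRight_apply, smul_eq_mul, gramCoord_add, gramCoord_smul,
    gramCoord_left h, gramCoord_left h', gramCoord_right, hD', hsymm]
  have hs : 0 < √(gramDet (a x) (b x)) := Real.sqrt_pos.2 h
  have hsq : √(gramDet (a x) (b x)) ^ 2 = gramDet (a x) (b x) := Real.sq_sqrt h.le
  simp only [hzdef, hwdef, gramCoord, gramDet_comm (a x) (b x), real_inner_comm (a x) (b x)]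
  set s := √(gramDet (a x) (b x))
  rw [← hsq]
  field_simp
  simp only [gramDet]
  ring

end Divergence

/-- The plane of parameters. -/
local notation "E²" => EuclideanSpace ℝ (Fin 2)

/-- The ambient space. -/
local notation "E³" => EuclideanSpace ℝ (Fin 3)

/-! ### Local parametrizations: frames and smooth local inverses -/

namespace LocalParam

variable {M : Set E³}

/-- The coordinate vector fields `∂₀S` and `∂₁S` of a local parametrization. -/
def coordVec (P : LocalParam M) (i : Fin 2) (x : E²) : E³ :=
  fderiv ℝ P.S x (EuclideanSpace.single i 1)

/-- The determinant of the first fundamental form. -/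
def gram (P : LocalParam M) (x : E²) : ℝ := gramDet (P.coordVec 0 x) (P.coordVec 1 x)

theorem det_metric (P : LocalParam M) (x : E²) : (P.metric x).det = P.gram x := by
  simp only [metric, gram, gramDet, coordVec, Matrix.det_fin_two, Matrix.of_apply]
  rw [real_inner_comm (fderiv ℝ P.S x (EuclideanSpace.single 0 1))
    (fderiv ℝ P.S x (EuclideanSpace.single 1 1)), sq]

theorem contDiffAt (P : LocalParam M) {x : E²} (hx : x ∈ P.U) : ContDiffAt ℝ ∞ P.S x :=
  P.contDiffOn.contDiffAt (P.isOpen_U.mem_nhds hx)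

theorem differentiableAt (P : LocalParam M) {x : E²} (hx : x ∈ P.U) :
    DifferentiableAt ℝ P.S x :=
  (P.contDiffAt hx).differentiableAt (by simp)

theorem mem (P : LocalParam M) {x : E²} (hx : x ∈ P.U) : P.S x ∈ M := by
  obtain ⟨O, -, hO⟩ := P.image_open P.U subset_rfl P.isOpen_U
  exact (hO.subset (mem_image_of_mem _ hx)).1

theorem _root_.EuclideanSpace.eq_single_add_single (v : E²) :
    v = v 0 • EuclideanSpace.single 0 (1 : ℝ) + v 1 • EuclideanSpace.single 1 (1 : ℝ) := by
  ext i
  fin_cases i <;> simp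

theorem fderiv_apply (P : LocalParam M) (x v : E²) :
    fderiv ℝ P.S x v = v 0 • P.coordVec 0 x + v 1 • P.coordVec 1 x := by
  conv_lhs => rw [EuclideanSpace.eq_single_add_single v]
  simp [coordVec]

theorem linearIndependent_coordVec (P : LocalParam M) {x : E²} (hx : x ∈ P.U) :
    LinearIndependent ℝ ![P.coordVec 0 x, P.coordVec 1 x] := by
  rw [LinearIndependent.pair_iff]
  intro s t hst
  have h1 : fderiv ℝ P.S x (!₂[s, t]) = 0 := by
    rw [P.fderiv_apply]; simpa using hst
  have h2 := P.injective_fderiv x hx (h1.trans (map_zero _).symm)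
  exact ⟨by simpa using congrArg (fun v : E² => v 0) h2,
    by simpa using congrArg (fun v : E² => v 1) h2⟩

theorem gram_pos (P : LocalParam M) {x : E²} (hx : x ∈ P.U) : 0 < P.gram x :=
  gramDet_pos (P.linearIndependent_coordVec hx)

theorem coordVec_ne_zero (P : LocalParam M) {x : E²} (hx : x ∈ P.U) (i : Fin 2) :
    P.coordVec i x ≠ 0 := by
  have h := (P.linearIndependent_coordVec hx).ne_zero i
  fin_cases i <;> simpa using h

theorem range_fderiv (P : LocalParam M) (x : E²) :
    LinearMap.range (fderiv ℝ P.S x).toLinearMap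
      = Submodule.span ℝ {P.coordVec 0 x, P.coordVec 1 x} := by
  ext v
  rw [LinearMap.mem_range, Submodule.mem_span_pair]
  constructor
  · rintro ⟨w, rfl⟩
    exact ⟨w 0, w 1, (P.fderiv_apply x w).symm⟩
  · rintro ⟨s, t, rfl⟩
    exact ⟨!₂[s, t], by simp [P.fderiv_apply]⟩

theorem contDiffOn_coordVec (P : LocalParam M) (i : Fin 2) :
    ContDiffOn ℝ ∞ (P.coordVec i) P.U :=
  (P.contDiffOn.fderiv_of_isOpen P.isOpen_U (by simp)).clm_apply contDiffOn_const

theorem differentiableAt_coordVec (P : LocalParam M) (i : Fin 2) {x : E²} (hx : x ∈ P.U) :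
    DifferentiableAt ℝ (P.coordVec i) x :=
  ((P.contDiffOn_coordVec i).contDiffAt (P.isOpen_U.mem_nhds hx)).differentiableAt (by simp)

theorem fderiv_coordVec_comm (P : LocalParam M) {x : E²} (hx : x ∈ P.U) :
    fderiv ℝ (P.coordVec 0) x (EuclideanSpace.single 1 1)
      = fderiv ℝ (P.coordVec 1) x (EuclideanSpace.single 0 1) := by
  have hd : DifferentiableAt ℝ (fderiv ℝ P.S) x :=
    ((P.contDiffOn.fderiv_of_isOpen P.isOpen_U (m := ∞) (by simp)).contDiffAt
      (P.isOpen_U.mem_nhds hx)).differentiableAt (by simp)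
  have key : ∀ i v, fderiv ℝ (P.coordVec i) x v
      = fderiv ℝ (fderiv ℝ P.S) x v (EuclideanSpace.single i 1) := by
    intro i v
    have := (hd.hasFDerivAt.clm_apply
      (hasFDerivAt_const (EuclideanSpace.single i (1 : ℝ)) x)).fderiv
    change fderiv ℝ (fun y => fderiv ℝ P.S y (EuclideanSpace.single i 1)) x v = _
    rw [this]
    simp
  rw [key, key]
  exact ((P.contDiffAt hx).isSymmSndFDerivAt (by
    simpa using (WithTop.coe_le_coe.2 le_top : ((2 : ℕ∞) : WithTop ℕ∞) ≤ ∞))).eq _ _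

/-- `φ` is a continuously differentiable map of an open set `O` of the ambient space to the
parameter domain which inverts the parametrization on `M ∩ O`. -/
structure IsLocalInverse (P : LocalParam M) (O : Set E³) (φ : E³ → E²) : Prop where
  isOpen : IsOpen O
  contDiffOn : ContDiffOn ℝ 1 φ O
  mapsTo : MapsTo φ O P.U
  right_inv : ∀ q ∈ M ∩ O, P.S (φ q) = q

theorem IsLocalInverse.left_inv {P : LocalParam M} {O : Set E³} {φ : E³ → E²}
    (h : P.IsLocalInverse O φ) {x : E²} (hx : x ∈ P.U) (hxO : P.S x ∈ O) : φ (P.S x) = x :=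
  P.injOn (h.mapsTo hxO) hx (h.right_inv _ ⟨P.mem hx, hxO⟩)

/-- If `L` is a left inverse of the differential of `S` at `x₀`, then `L ∘ S` is a local
diffeomorphism of the plane, and composing its inverse with `L` inverts `S`. -/
theorem exists_isLocalInverse (P : LocalParam M) {x₀ : E²} (hx₀ : x₀ ∈ P.U) :
    ∃ O φ, P.S x₀ ∈ O ∧ P.IsLocalInverse O φ := by
  obtain ⟨L₀, hL₀⟩ := (fderiv ℝ P.S x₀).toLinearMap.exists_leftInverse_of_injective
    (LinearMap.ker_eq_bot.2 (P.injective_fderiv x₀ hx₀))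
  let L : E³ →L[ℝ] E² := LinearMap.toContinuousLinearMap L₀
  have hf : ContDiffAt ℝ 1 (fun x => L (P.S x)) x₀ :=
    L.contDiff.contDiffAt.comp x₀ ((P.contDiffAt hx₀).of_le (by simp))
  have hf' : HasFDerivAt (fun x => L (P.S x))
      ((ContinuousLinearEquiv.refl ℝ E² : E² ≃L[ℝ] E²) : E² →L[ℝ] E²) x₀ := by
    refine (L.hasFDerivAt.comp x₀ (P.differentiableAt hx₀).hasFDerivAt).congr_fderiv ?_
    exact ContinuousLinearMap.ext fun v => LinearMap.congr_fun hL₀ v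
  let e := hf.toOpenPartialHomeomorph _ hf' one_ne_zero
  have hsymm : ContDiffAt ℝ 1 e.symm (L (P.S x₀)) := hf.to_localInverse hf' one_ne_zero
  have hx₀e : x₀ ∈ e.source := hf.mem_toOpenPartialHomeomorph_source hf' one_ne_zero
  have hsx₀ : e.symm (L (P.S x₀)) = x₀ := e.left_inv hx₀e
  have hev : ∀ᶠ y in 𝓝 (L (P.S x₀)), ContDiffAt ℝ 1 e.symm y ∧ e.symm y ∈ P.U := by
    refine (hsymm.eventually (by simp)).and ?_
    apply hsymm.continuousAt.eventually_mem
    rw [hsx₀]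
    exact P.isOpen_U.mem_nhds hx₀
  obtain ⟨Y, hY, hYo, hYx⟩ := eventually_nhds_iff.1 hev
  obtain ⟨O, hO, hOM⟩ := P.image_open (P.U ∩ e.source) inter_subset_left
    (P.isOpen_U.inter e.open_source)
  refine ⟨O ∩ L ⁻¹' Y, fun q => e.symm (L q), ⟨?_, hYx⟩, hO.inter (hYo.preimage L.continuous),
    ?_, ?_, ?_⟩
  · exact (hOM.subset (mem_image_of_mem _ ⟨hx₀, hx₀e⟩)).2
  · intro q hq
    exact ((hY _ hq.2).1.comp q L.contDiff.contDiffAt).contDiffWithinAt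
  · exact fun q hq => (hY _ hq.2).2
  · rintro q ⟨hqM, hqO, -⟩
    obtain ⟨x, hx, rfl⟩ := hOM.symm.subset ⟨hqM, hqO⟩
    congr 1
    exact e.left_inv hx.2

/-- Near a common point, two parametrizations differ by a change of variables. -/
theorem exists_transition (P Q : LocalParam M) {x y : E²} (hx : x ∈ Q.U) (hy : y ∈ P.U)
    (hxy : P.S y = Q.S x) :
    ∃ τ : E² → E², τ x = y ∧ DifferentiableAt ℝ τ x ∧
      (∀ᶠ z in 𝓝 x, τ z ∈ P.U ∧ P.S (τ z) = Q.S z) ∧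
      fderiv ℝ Q.S x = fderiv ℝ P.S y ∘L fderiv ℝ τ x := by
  obtain ⟨O, φ, hyO, hφ⟩ := P.exists_isLocalInverse hy
  have hxO : Q.S x ∈ O := hxy ▸ hyO
  have hτx : φ (Q.S x) = y := by rw [← hxy]; exact hφ.left_inv hy hyO
  have hd : DifferentiableAt ℝ (φ ∘ Q.S) x :=
    ((hφ.contDiffOn.contDiffAt (hφ.isOpen.mem_nhds hxO)).differentiableAt (by simp)).comp x
      (Q.differentiableAt hx)
  have hev : ∀ᶠ z in 𝓝 x, φ (Q.S z) ∈ P.U ∧ P.S (φ (Q.S z)) = Q.S z := by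
    filter_upwards [(Q.differentiableAt hx).continuousAt.eventually_mem
      (hφ.isOpen.mem_nhds hxO), Q.isOpen_U.mem_nhds hx] with z hz hzU
    exact ⟨hφ.mapsTo hz, hφ.right_inv _ ⟨Q.mem hzU, hz⟩⟩
  refine ⟨φ ∘ Q.S, hτx, hd, hev, ?_⟩
  have hP : HasFDerivAt P.S (fderiv ℝ P.S y) ((φ ∘ Q.S) x) := by
    rw [Function.comp_apply, hτx]; exact (P.differentiableAt hy).hasFDerivAt
  exact ((hP.comp x hd.hasFDerivAt).congr_of_eventuallyEq
    (hev.mono fun z hz => hz.2.symm)).fderiv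

theorem tangentPlane_eq (P : LocalParam M) {x : E²} (hx : x ∈ P.U) :
    tangentPlane M (P.S x) = Submodule.span ℝ {P.coordVec 0 x, P.coordVec 1 x} := by
  rw [← P.range_fderiv]
  apply le_antisymm
  · refine iSup_le fun Q => iSup_le fun y => iSup_le fun hy => ?_
    obtain ⟨τ, -, -, -, h⟩ := P.exists_transition Q hy.1 hx hy.2.symm
    rw [h]
    exact LinearMap.range_comp_le_range _ _
  · exact le_iSup_of_le P (le_iSup_of_le x (le_iSup_of_le ⟨hx, rfl⟩ le_rfl))

end LocalParam

/-! ### The area measure in local parametrizations -/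

namespace LocalParam

variable {M : Set E³}

theorem measurable_coordVec (P : LocalParam M) (i : Fin 2) : Measurable (P.coordVec i) :=
  measurable_fderiv_apply_const ℝ P.S _

theorem measurable_gram (P : LocalParam M) : Measurable P.gram := by
  have h := P.measurable_coordVec
  exact (((h 0).inner (h 0)).mul ((h 1).inner (h 1))).sub (((h 0).inner (h 1)).pow_const 2)

theorem measurable_density (P : LocalParam M) :
    Measurable fun x => ENNReal.ofReal √(P.gram x) :=
  P.measurable_gram.sqrt.ennreal_ofReal

theorem continuousOn (P : LocalParam M) : ContinuousOn P.S P.U := P.contDiffOn.continuousOn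

theorem continuousOn_gram (P : LocalParam M) : ContinuousOn P.gram P.U := by
  have h := fun i => (P.contDiffOn_coordVec i).continuousOn
  exact (((h 0).inner (h 0)).mul ((h 1).inner (h 1))).sub (((h 0).inner (h 1)).pow 2)

theorem measurableEmbedding_domRestrict (P : LocalParam M) :
    MeasurableEmbedding (P.U.domRestrict P.S) :=
  P.continuousOn.measurableEmbedding P.isOpen_U.measurableSet P.injOn

theorem patchArea_eq_map (P : LocalParam M) :
    P.patchArea = Measure.map (P.U.domRestrict P.S)
      (((volume : Measure E²).withDensity fun x => ENNReal.ofReal √(P.gram x)).comap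
        ((↑) : P.U → E²)) := by
  have hU := P.isOpen_U.measurableSet
  have hS : AEMeasurable P.S ((volume.withDensity fun x => ENNReal.ofReal √(P.gram x)).restrict
      P.U) := P.continuousOn.aemeasurable hU
  rw [patchArea]
  simp only [det_metric]
  rw [← restrict_withDensity hU]
  ext A hA
  rw [Measure.map_apply_of_aemeasurable hS hA,
    Measure.map_apply P.measurableEmbedding_domRestrict.measurable hA,
    (MeasurableEmbedding.subtype_coe hU).comap_apply, Measure.restrict_apply' hU]
  congr 1
  ext x
  simp [and_comm, Set.domRestrict]

theorem patchArea_apply (P : LocalParam M) {A : Set E³} (hA : MeasurableSet A) :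
    P.patchArea A = ∫⁻ x in P.U ∩ P.S ⁻¹' A, ENNReal.ofReal √(P.gram x) := by
  have hU := P.isOpen_U.measurableSet
  rw [P.patchArea_eq_map, Measure.map_apply P.measurableEmbedding_domRestrict.measurable hA,
    (MeasurableEmbedding.subtype_coe hU).comap_apply, withDensity_apply']
  congr 2
  ext x
  simp [and_comm, Set.domRestrict]

theorem measurableSet_inter_preimage (P : LocalParam M) {A : Set E³} (hA : MeasurableSet A) :
    MeasurableSet (P.U ∩ P.S ⁻¹' A) := by
  have := P.isOpen_U.measurableSet.subtype_image
    (P.measurableEmbedding_domRestrict.measurable hA)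
  convert this using 1
  ext x
  simp [and_comm, Set.domRestrict]

theorem measurableSet_image (P : LocalParam M) {W : Set E²} (hW : MeasurableSet W)
    (hWU : W ⊆ P.U) : MeasurableSet (P.S '' W) := by
  have := P.measurableEmbedding_domRestrict.measurableSet_image.2
    (measurable_subtype_coe hW : MeasurableSet ((↑) ⁻¹' W : Set P.U))
  convert this using 1
  ext q
  constructor
  · rintro ⟨x, hx, rfl⟩
    exact ⟨⟨x, hWU hx⟩, hx, rfl⟩
  · rintro ⟨x, hx, rfl⟩
    exact ⟨x, hx, rfl⟩

/-- The image of the parametrization, a relatively open subset of `M`. -/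
def patch (P : LocalParam M) : Set E³ := P.S '' P.U

theorem measurableSet_patch (P : LocalParam M) : MeasurableSet P.patch :=
  P.measurableSet_image P.isOpen_U.measurableSet subset_rfl

theorem patch_subset (P : LocalParam M) : P.patch ⊆ M := by
  rintro _ ⟨x, hx, rfl⟩
  exact P.mem hx

theorem patchArea_image (P : LocalParam M) {W : Set E²} (hW : MeasurableSet W)
    (hWU : W ⊆ P.U) : P.patchArea (P.S '' W) = ∫⁻ x in W, ENNReal.ofReal √(P.gram x) := by
  rw [P.patchArea_apply (P.measurableSet_image hW hWU), inter_comm,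
    P.injOn.preimage_image_inter hWU]

theorem patchArea_inter_patch (P : LocalParam M) {A : Set E³} (hA : MeasurableSet A) :
    P.patchArea (A ∩ P.patch) = P.patchArea A := by
  rw [P.patchArea_apply hA, P.patchArea_apply (hA.inter P.measurableSet_patch)]
  congr 2
  ext x
  simp only [patch, mem_inter_iff, mem_preimage]
  exact ⟨fun h => ⟨h.1, h.2.1⟩, fun h => ⟨h.1, h.2, mem_image_of_mem _ h.1⟩⟩

theorem _root_.EuclideanSpace.det_fin_two (A : E² →L[ℝ] E²) :
    A.det = A (EuclideanSpace.single 0 1) 0 * A (EuclideanSpace.single 1 1) 1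
      - A (EuclideanSpace.single 1 1) 0 * A (EuclideanSpace.single 0 1) 1 := by
  rw [ContinuousLinearMap.det, ← LinearMap.det_toMatrix (EuclideanSpace.basisFun (Fin 2) ℝ).toBasis,
    Matrix.det_fin_two]
  simp [LinearMap.toMatrix_apply]

/-- Change of variables for the area element. -/
theorem sqrt_gram_eq (P Q : LocalParam M) {x y : E²} {A : E² →L[ℝ] E²}
    (h : fderiv ℝ Q.S x = fderiv ℝ P.S y ∘L A) :
    √(Q.gram x) = |A.det| * √(P.gram y) := by
  have hv : ∀ i, Q.coordVec i x = A (EuclideanSpace.single i 1) 0 • P.coordVec 0 y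
      + A (EuclideanSpace.single i 1) 1 • P.coordVec 1 y := by
    intro i
    rw [coordVec, h, ContinuousLinearMap.comp_apply, P.fderiv_apply]
  have : Q.gram x = A.det ^ 2 * P.gram y := by
    rw [gram, hv, hv, EuclideanSpace.det_fin_two, gram]
    simp only [gramDet, inner_add_left, inner_add_right, real_inner_smul_left,
      real_inner_smul_right, real_inner_comm (P.coordVec 0 y) (P.coordVec 1 y)]
    ring
  rw [this, Real.sqrt_mul (sq_nonneg _), Real.sqrt_sq_eq_abs]

/-- The area elements of two parametrizations agree on the overlap of the patches: one inequality,
from which the other follows by exchanging the roles. -/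
theorem patchArea_le (P Q : LocalParam M) {A : Set E³} (hA : MeasurableSet A)
    (hAP : A ⊆ P.patch) : Q.patchArea A ≤ P.patchArea A := by
  classical
  rw [P.patchArea_apply hA, Q.patchArea_apply hA]
  set B := Q.U ∩ Q.S ⁻¹' A
  let τ : E² → E² := fun x => Function.invFunOn P.S P.U (Q.S x)
  have hτ : ∀ x ∈ B, τ x ∈ P.U ∧ P.S (τ x) = Q.S x := fun x hx =>
    Function.invFunOn_pos (hAP hx.2)
  have hex : ∀ x ∈ B, ∃ τ' : E² →L[ℝ] E², HasFDerivWithinAt τ τ' B x ∧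
      √(Q.gram x) = |τ'.det| * √(P.gram (τ x)) := by
    intro x hx
    obtain ⟨σ, hσx, hσd, hσ, hfd⟩ := P.exists_transition Q hx.1 (hτ x hx).1 (hτ x hx).2
    refine ⟨fderiv ℝ σ x, ?_, P.sqrt_gram_eq Q hfd⟩
    refine hσd.hasFDerivAt.hasFDerivWithinAt.congr_of_eventuallyEq ?_ hσx.symm
    filter_upwards [mem_nhdsWithin_of_mem_nhds hσ, self_mem_nhdsWithin] with z hz hzB
    exact P.injOn (hτ z hzB).1 hz.1 ((hτ z hzB).2.trans hz.2.symm)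
  choose! τ' hτ' hg using hex
  have hinj : InjOn τ B := fun x hx y hy hxy =>
    Q.injOn hx.1 hy.1 (by rw [← (hτ x hx).2, ← (hτ y hy).2, hxy])
  have hB : MeasurableSet B := Q.measurableSet_inter_preimage hA
  calc ∫⁻ x in B, ENNReal.ofReal √(Q.gram x)
      = ∫⁻ x in B, ENNReal.ofReal |(τ' x).det| * ENNReal.ofReal √(P.gram (τ x)) := by
        refine setLIntegral_congr_fun hB fun x hx => ?_
        simp only [hg x hx]
        rw [ENNReal.ofReal_mul (abs_nonneg _)]
    _ = ∫⁻ y in τ '' B, ENNReal.ofReal √(P.gram y) :=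
        (lintegral_image_eq_lintegral_abs_det_fderiv_mul volume hB hτ' hinj
          fun y => ENNReal.ofReal √(P.gram y)).symm
    _ ≤ ∫⁻ y in P.U ∩ P.S ⁻¹' A, ENNReal.ofReal √(P.gram y) := by
        refine lintegral_mono_set ?_
        rintro _ ⟨x, hx, rfl⟩
        refine ⟨(hτ x hx).1, ?_⟩
        rw [mem_preimage, (hτ x hx).2]
        exact hx.2

theorem patchArea_le_areaMeasure (P : LocalParam M) : P.patchArea ≤ areaMeasure M :=
  le_iSup (fun P : LocalParam M => P.patchArea) P

/-- The supremum over all parametrizations is on each patch the area element of that patch. For the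
upper bound, the measure that agrees with the supremum outside of the patch and with the area
element on it dominates the area element of every parametrization. -/
theorem restrict_areaMeasure (P : LocalParam M) :
    (areaMeasure M).restrict P.patch = P.patchArea := by
  have hV := P.measurableSet_patch
  have hle : areaMeasure M ≤ (areaMeasure M).restrict P.patchᶜ + P.patchArea := by
    refine iSup_le fun Q => Measure.le_iff.2 fun A hA => ?_
    rw [← measure_inter_add_sdiff A hV, add_comm, Measure.add_apply, Measure.restrict_apply hA]
    exact add_le_add (Q.patchArea_le_areaMeasure _)
      ((P.patchArea_le Q (hA.inter hV) inter_subset_right).trans (measure_mono inter_subset_left))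
  ext A hA
  rw [Measure.restrict_apply hA, ← P.patchArea_inter_patch hA]
  refine le_antisymm ((hle _).trans ?_) (P.patchArea_le_areaMeasure _)
  rw [Measure.add_apply, Measure.restrict_apply (hA.inter hV), inter_assoc, inter_compl_self,
    inter_empty, measure_empty, zero_add]

theorem areaMeasure_image (P : LocalParam M) {W : Set E²} (hW : MeasurableSet W)
    (hWU : W ⊆ P.U) : areaMeasure M (P.S '' W) = ∫⁻ x in W, ENNReal.ofReal √(P.gram x) := by
  rw [← P.patchArea_image hW hWU, ← P.restrict_areaMeasure,
    Measure.restrict_apply (P.measurableSet_image hW hWU),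
    inter_eq_self_of_subset_left (show P.S '' W ⊆ P.patch from image_mono hWU)]

end LocalParam

/-- The area measure is concentrated on the surface. -/
theorem areaMeasure_compl {M : Set E³} (hM : MeasurableSet M) : areaMeasure M Mᶜ = 0 := by
  have hle : areaMeasure M ≤ (areaMeasure M).restrict M := by
    refine iSup_le fun P => Measure.le_iff.2 fun A hA => ?_
    rw [Measure.restrict_apply hA, ← P.patchArea_inter_patch hA]
    exact (measure_mono (inter_subset_inter_right _ P.patch_subset)).trans
      (P.patchArea_le_areaMeasure _)
  refine le_antisymm ((hle _).trans ?_) bot_le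
  rw [Measure.restrict_apply hM.compl, compl_inter_self, measure_empty]

theorem ae_mem_areaMeasure {M : Set E³} (hM : MeasurableSet M) : ∀ᵐ q ∂areaMeasure M, q ∈ M :=
  areaMeasure_compl hM

theorem IsClosedSurface.measurableSet {M : Set E³} (hM : IsClosedSurface M) : MeasurableSet M :=
  hM.isCompact.isClosed.measurableSet

theorem IsClosedSurface.isFiniteMeasure {M : Set E³} (hM : IsClosedSurface M) :
    IsFiniteMeasure (areaMeasure M) := by
  have hfin : areaMeasure M M < ⊤ := by
    refine hM.isCompact.measure_lt_top_of_nhdsWithin fun p hp => ?_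
    obtain ⟨P, x, hx, rfl⟩ := hM.exists_param p hp
    obtain ⟨r, hr, hrU⟩ := Metric.nhds_basis_closedBall.mem_iff.1 (P.isOpen_U.mem_nhds hx)
    have hbU : Metric.ball x r ⊆ P.U := Metric.ball_subset_closedBall.trans hrU
    obtain ⟨O, hO, hOM⟩ := P.image_open _ hbU Metric.isOpen_ball
    refine ⟨P.S '' Metric.ball x r, ?_, ?_⟩
    · rw [hOM]
      exact Filter.inter_mem self_mem_nhdsWithin (mem_nhdsWithin_of_mem_nhds
        (hO.mem_nhds (hOM.subset (mem_image_of_mem _ (Metric.mem_ball_self hr))).2))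
    · rw [P.areaMeasure_image measurableSet_ball hbU]
      have hint : IntegrableOn (fun y => √(P.gram y)) (Metric.closedBall x r) :=
        ((P.continuousOn_gram.mono hrU).sqrt).integrableOn_compact (isCompact_closedBall x r)
      exact (hint.mono_set Metric.ball_subset_closedBall).lintegral_lt_top
  refine ⟨?_⟩
  rw [← union_compl_self M]
  refine (measure_union_le _ _).trans_lt ?_
  rwa [areaMeasure_compl hM.measurableSet, add_zero]

namespace LocalParam

variable {M : Set E³}

/-- Integration in a patch. No measurability of `f` is needed, since the parametrization is a
measurable embedding. -/
theorem integral_areaMeasure (P : LocalParam M) (hM : MeasurableSet M) {f : E³ → ℝ}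
    (hf : ∀ q ∈ M, q ∉ P.patch → f q = 0) :
    ∫ q, f q ∂areaMeasure M = ∫ x in P.U, √(P.gram x) * f (P.S x) := by
  have hU := P.isOpen_U.measurableSet
  have h1 : ∫ q, f q ∂areaMeasure M = ∫ q in P.patch, f q ∂areaMeasure M := by
    refine (setIntegral_eq_integral_of_ae_compl_eq_zero ?_).symm
    filter_upwards [ae_mem_areaMeasure hM] with q hq using hf q hq
  rw [h1, P.restrict_areaMeasure, P.patchArea_eq_map,
    P.measurableEmbedding_domRestrict.integral_map]
  change ∫ x : P.U, (fun y => f (P.S y)) (x : E²) ∂_ = _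
  rw [integral_subtype_comap hU (fun y => f (P.S y)),
    setIntegral_withDensity_eq_setIntegral_toReal_smul P.measurable_density
      (by simp) _ hU]
  simp [ENNReal.toReal_ofReal (Real.sqrt_nonneg _)]

theorem integrable_areaMeasure (P : LocalParam M) (hM : MeasurableSet M) {f : E³ → ℝ}
    (hf : ∀ q ∈ M, q ∉ P.patch → f q = 0)
    (hint : IntegrableOn (fun x => √(P.gram x) * f (P.S x)) P.U) :
    Integrable f (areaMeasure M) := by
  have hU := P.isOpen_U.measurableSet
  have hae : P.patch.indicator f =ᵐ[areaMeasure M] f := by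
    filter_upwards [ae_mem_areaMeasure hM] with q hq
    by_cases hqP : q ∈ P.patch
    · rw [indicator_of_mem hqP]
    · rw [indicator_of_notMem hqP, hf q hq hqP]
  refine Integrable.congr ?_ hae
  rw [integrable_indicator_iff P.measurableSet_patch, IntegrableOn, P.restrict_areaMeasure,
    P.patchArea_eq_map, P.measurableEmbedding_domRestrict.integrable_map_iff]
  change Integrable ((fun y => f (P.S y)) ∘ ((↑) : P.U → E²)) _
  rw [← (MeasurableEmbedding.subtype_coe hU).integrable_map_iff,
    (MeasurableEmbedding.subtype_coe hU).map_comap, Subtype.range_coe, restrict_withDensity hU,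
    integrable_withDensity_iff_integrable_smul' P.measurable_density (by simp)]
  simpa [ENNReal.toReal_ofReal (Real.sqrt_nonneg _), IntegrableOn] using hint

end LocalParam

/-! ### The divergence theorem in a half plane -/

/-- The identification of `ℝ × ℝ` with the Euclidean plane. -/
def planePoint (p : ℝ × ℝ) : E² := !₂[p.1, p.2]

@[simp] theorem planePoint_apply_zero (p : ℝ × ℝ) : planePoint p 0 = p.1 := rfl

@[simp] theorem planePoint_apply_one (p : ℝ × ℝ) : planePoint p 1 = p.2 := rfl

theorem planePoint_eq (s t : ℝ) : planePoint (s, t)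
    = s • EuclideanSpace.single 0 (1 : ℝ) + t • EuclideanSpace.single 1 (1 : ℝ) := by
  rw [EuclideanSpace.eq_single_add_single (planePoint (s, t))]
  simp

theorem planePoint_eq_self {x : E²} (hx : x 1 = 0) : planePoint (x 0, 0) = x := by
  ext i
  fin_cases i
  · rfl
  · exact hx.symm

theorem measurePreserving_planePoint : MeasurePreserving planePoint :=
  (PiLp.volume_preserving_toLp (Fin 2)).comp (volume_preserving_finTwoArrow ℝ).symm

theorem measurableEmbedding_planePoint : MeasurableEmbedding planePoint :=
  (MeasurableEquiv.toLp 2 (Fin 2 → ℝ)).measurableEmbedding.comp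
    (MeasurableEquiv.finTwoArrow (α := ℝ)).symm.measurableEmbedding

theorem hasDerivAt_planePoint_fst (s t : ℝ) :
    HasDerivAt (fun s => planePoint (s, t)) (EuclideanSpace.single 0 (1 : ℝ)) s := by
  simp only [planePoint_eq]
  simpa using ((hasDerivAt_id s).smul_const (EuclideanSpace.single 0 (1 : ℝ) : E²)).add_const
    (t • EuclideanSpace.single 1 (1 : ℝ))

theorem hasDerivAt_planePoint_snd (s t : ℝ) :
    HasDerivAt (fun t => planePoint (s, t)) (EuclideanSpace.single 1 (1 : ℝ)) t := by
  simp only [planePoint_eq]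
  simpa using ((hasDerivAt_id t).smul_const (EuclideanSpace.single 1 (1 : ℝ) : E²)).const_add
    (s • EuclideanSpace.single 0 (1 : ℝ))

theorem isometry_planePoint_fst (t : ℝ) : Isometry fun s => planePoint (s, t) :=
  Isometry.of_dist_eq fun s s' => by
    simp [EuclideanSpace.dist_eq, Fin.sum_univ_two, Real.sqrt_sq_eq_abs, Real.dist_eq]

theorem isometry_planePoint_snd (s : ℝ) : Isometry fun t => planePoint (s, t) :=
  Isometry.of_dist_eq fun t t' => by
    simp [EuclideanSpace.dist_eq, Fin.sum_univ_two, Real.sqrt_sq_eq_abs, Real.dist_eq]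

theorem contDiff_planePoint_fst (t : ℝ) : ContDiff ℝ 1 fun s => planePoint (s, t) := by
  simp only [planePoint_eq]
  fun_prop

theorem contDiff_planePoint_snd (s : ℝ) : ContDiff ℝ 1 fun t => planePoint (s, t) := by
  simp only [planePoint_eq]
  fun_prop

theorem integrable_fderiv_apply {F : E² → ℝ} (hF : ContDiff ℝ 1 F) (hc : HasCompactSupport F)
    (v : E²) : Integrable fun x => fderiv ℝ F x v :=
  ((hF.continuous_fderiv (by simp)).clm_apply continuous_const).integrable_of_hasCompactSupport
    (hc.fderiv_apply (𝕜 := ℝ) v)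

theorem setIntegral_halfPlane_eq {g : E² → ℝ} :
    ∫ x in {x : E² | 0 < x 1}, g x = ∫ p in univ ×ˢ Ioi (0 : ℝ), g (planePoint p) := by
  rw [← measurePreserving_planePoint.setIntegral_preimage_emb measurableEmbedding_planePoint]
  congr 2
  ext p
  simp

theorem setIntegral_halfPlane_fderiv_zero {F : E² → ℝ} (hF : ContDiff ℝ 1 F)
    (hc : HasCompactSupport F) :
    ∫ x in {x : E² | 0 < x 1}, fderiv ℝ F x (EuclideanSpace.single 0 1) = 0 := by
  have hint : Integrable (fun p => fderiv ℝ F (planePoint p) (EuclideanSpace.single 0 1)) :=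
    (measurePreserving_planePoint.integrable_comp_emb measurableEmbedding_planePoint).2
      (integrable_fderiv_apply hF hc _)
  rw [setIntegral_halfPlane_eq, Measure.volume_eq_prod, ← Measure.prod_restrict,
    Measure.restrict_univ, integral_prod_symm]
  · refine integral_eq_zero_of_ae (ae_of_all _ fun t => ?_)
    have hd : ∀ s, HasDerivAt (fun s => F (planePoint (s, t)))
        (fderiv ℝ F (planePoint (s, t)) (EuclideanSpace.single 0 1)) s := fun s =>
      (hF.differentiable (by simp) _).hasFDerivAt.comp_hasDerivAt s (hasDerivAt_planePoint_fst s t)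
    have hct : HasCompactSupport fun s => F (planePoint (s, t)) :=
      hc.comp_isClosedEmbedding (isometry_planePoint_fst t).isClosedEmbedding
    have hF' : ContDiff ℝ 1 fun s => F (planePoint (s, t)) := hF.comp (contDiff_planePoint_fst t)
    refine integral_eq_zero_of_hasDerivAt_of_integrable hd ?_
      (hF'.continuous.integrable_of_hasCompactSupport hct)
    have : (fun s => fderiv ℝ F (planePoint (s, t)) (EuclideanSpace.single 0 1))
        = deriv fun s => F (planePoint (s, t)) := funext fun s => (hd s).deriv.symm
    rw [this]
    exact (hF'.continuous_deriv (by simp)).integrable_of_hasCompactSupport hct.deriv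
  · rw [← Measure.restrict_univ (μ := (volume : Measure ℝ)), Measure.prod_restrict,
      Measure.restrict_univ, ← Measure.volume_eq_prod]
    exact hint.integrableOn

theorem setIntegral_halfPlane_fderiv_one {F : E² → ℝ} (hF : ContDiff ℝ 1 F)
    (hc : HasCompactSupport F) :
    ∫ x in {x : E² | 0 < x 1}, fderiv ℝ F x (EuclideanSpace.single 1 1)
      = -∫ s, F (planePoint (s, 0)) := by
  have hint : Integrable (fun p => fderiv ℝ F (planePoint p) (EuclideanSpace.single 1 1)) :=
    (measurePreserving_planePoint.integrable_comp_emb measurableEmbedding_planePoint).2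
      (integrable_fderiv_apply hF hc _)
  rw [setIntegral_halfPlane_eq, Measure.volume_eq_prod, ← Measure.prod_restrict,
    Measure.restrict_univ, integral_prod, ← integral_neg]
  · refine integral_congr_ae (ae_of_all _ fun s => ?_)
    have hd : ∀ t, HasDerivAt (fun t => F (planePoint (s, t)))
        (fderiv ℝ F (planePoint (s, t)) (EuclideanSpace.single 1 1)) t := fun t =>
      (hF.differentiable (by simp) _).hasFDerivAt.comp_hasDerivAt t (hasDerivAt_planePoint_snd s t)
    have hct : HasCompactSupport fun t => F (planePoint (s, t)) :=
      hc.comp_isClosedEmbedding (isometry_planePoint_snd s).isClosedEmbedding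
    have hF' : ContDiff ℝ 1 fun t => F (planePoint (s, t)) := hF.comp (contDiff_planePoint_snd s)
    have : (fun t => fderiv ℝ F (planePoint (s, t)) (EuclideanSpace.single 1 1))
        = deriv fun t => F (planePoint (s, t)) := funext fun t => (hd t).deriv.symm
    simp only [this]
    exact hct.integral_Ioi_deriv_eq hF' 0
  · nth_rewrite 1 [← Measure.restrict_univ (μ := (volume : Measure ℝ))]
    rw [Measure.prod_restrict, ← Measure.volume_eq_prod]
    exact hint.integrableOn

/-- The line bounding the half plane has measure zero. -/
theorem ae_apply_one_ne_zero : ∀ᵐ x : E², x 1 ≠ 0 := by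
  have h : ∀ᵐ p : ℝ × ℝ, p.2 ≠ 0 := by
    rw [Measure.volume_eq_prod]
    exact Measure.quasiMeasurePreserving_snd.ae (Measure.ae_ne volume 0)
  rw [← measurePreserving_planePoint.map_eq, measurableEmbedding_planePoint.ae_map_iff]
  exact h

/-! ### Gauss–Green in a local parametrization -/

theorem ContDiffOn.gramCoord {V W : Type*} [NormedAddCommGroup V] [InnerProductSpace ℝ V]
    [NormedAddCommGroup W] [NormedSpace ℝ W] {n : WithTop ℕ∞} {a b Y : W → V} {U : Set W}
    (ha : ContDiffOn ℝ n a U) (hb : ContDiffOn ℝ n b U) (hY : ContDiffOn ℝ n Y U)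
    (h : ∀ x ∈ U, gramDet (a x) (b x) ≠ 0) :
    ContDiffOn ℝ n (fun x => gramCoord (a x) (b x) (Y x)) U :=
  (((hb.inner ℝ hb).mul (ha.inner ℝ hY)).sub ((ha.inner ℝ hb).mul (hb.inner ℝ hY))).div
    (((ha.inner ℝ ha).mul (hb.inner ℝ hb)).sub ((ha.inner ℝ hb).pow 2)) h

namespace LocalParam

variable {M : Set E³}

theorem contDiffOn_gram (P : LocalParam M) : ContDiffOn ℝ ∞ P.gram P.U := by
  have h := P.contDiffOn_coordVec
  exact (((h 0).inner ℝ (h 0)).mul ((h 1).inner ℝ (h 1))).sub (((h 0).inner ℝ (h 1)).pow 2)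

/-- `C` is the half plane `{x₁ > 0}` in the parametrization `P`, up to points of the line
`{x₁ = 0}`. -/
def IsAdapted (P : LocalParam M) (C : Set E³) : Prop :=
  ∀ x ∈ P.U, (0 < x 1 → P.S x ∈ C) ∧ (x 1 < 0 → P.S x ∉ C)

/-- In an adapted parametrization: the unit tangent vector which on the line `{x₁ = 0}` is the inner
conormal of the boundary curve. -/
def conormal (P : LocalParam M) (x : E²) : E³ := gramNormal (P.coordVec 0 x) (P.coordVec 1 x)

/-- The components `√g z⁰` and `√g z¹` of a tangent field `Z = z⁰ ∂₀S + z¹ ∂₁S`, extended by zero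
outside of the parameter domain. -/
def flux (P : LocalParam M) (Z : E³ → E³) (i j : Fin 2) : E² → ℝ :=
  P.U.indicator fun x => √(P.gram x) * gramCoord (P.coordVec i x) (P.coordVec j x) (Z (P.S x))

theorem surfaceDiv_apply (P : LocalParam M) (Z : E³ → E³) {x : E²} (hx : x ∈ P.U) :
    surfaceDiv M Z (P.S x)
      = gramCoord (P.coordVec 0 x) (P.coordVec 1 x) (fderiv ℝ Z (P.S x) (P.coordVec 0 x))
        + gramCoord (P.coordVec 1 x) (P.coordVec 0 x) (fderiv ℝ Z (P.S x) (P.coordVec 1 x)) :=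
  trace_starProjection_comp (P.gram_pos hx) _ (P.tangentPlane_eq hx) _

theorem gramDet_pos_of_ne (P : LocalParam M) {i j : Fin 2} (hij : i ≠ j) {x : E²}
    (hx : x ∈ P.U) : 0 < gramDet (P.coordVec i x) (P.coordVec j x) := by
  have h := P.gram_pos hx
  rw [gram] at h
  fin_cases i <;> fin_cases j
  · exact absurd rfl hij
  · exact h
  · rw [gramDet_comm]; exact h
  · exact absurd rfl hij

section Flux

variable (P : LocalParam M) {Z : E³ → E³} {K : Set E²}

theorem flux_eq_zero (hK : M ∩ tsupport Z ⊆ P.S '' K) (hKU : K ⊆ P.U) (i j : Fin 2) {x : E²}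
    (hx : x ∉ K) : P.flux Z i j x = 0 := by
  by_cases hxU : x ∈ P.U
  · have hZ : Z (P.S x) = 0 := by
      refine image_eq_zero_of_notMem_tsupport fun h => hx ?_
      obtain ⟨y, hy, hxy⟩ := hK ⟨P.mem hxU, h⟩
      rwa [← P.injOn (hKU hy) hxU hxy]
    simp [flux, hxU, hZ, gramCoord]
  · exact indicator_of_notMem hxU _

theorem hasCompactSupport_flux (hKc : IsCompact K) (hK : M ∩ tsupport Z ⊆ P.S '' K)
    (hKU : K ⊆ P.U) (i j : Fin 2) : HasCompactSupport (P.flux Z i j) :=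
  HasCompactSupport.intro hKc fun _ hx => P.flux_eq_zero hK hKU i j hx

theorem contDiffOn_flux (hZ : ContDiff ℝ 1 Z) {i j : Fin 2} (hij : i ≠ j) :
    ContDiffOn ℝ 1 (fun x => √(P.gram x) *
      gramCoord (P.coordVec i x) (P.coordVec j x) (Z (P.S x))) P.U := by
  have hS : ContDiffOn ℝ 1 P.S P.U := P.contDiffOn.of_le (by simp)
  have hc : ∀ i, ContDiffOn ℝ 1 (P.coordVec i) P.U := fun i =>
    (P.contDiffOn_coordVec i).of_le (by simp)
  refine ContDiffOn.mul ?_ (ContDiffOn.gramCoord (hc i) (hc j) (hZ.comp_contDiffOn hS)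
    fun x hx => (P.gramDet_pos_of_ne hij hx).ne')
  exact (P.contDiffOn_gram.of_le (by simp)).sqrt fun x hx => (P.gram_pos hx).ne'

theorem flux_eventuallyEq (i j : Fin 2) {x : E²} (hx : x ∈ P.U) :
    P.flux Z i j =ᶠ[𝓝 x] fun x => √(P.gram x) *
      gramCoord (P.coordVec i x) (P.coordVec j x) (Z (P.S x)) := by
  filter_upwards [P.isOpen_U.mem_nhds hx] with y hy using indicator_of_mem hy _

theorem flux_eventuallyEq_zero (hKc : IsCompact K) (hK : M ∩ tsupport Z ⊆ P.S '' K)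
    (hKU : K ⊆ P.U) (i j : Fin 2) {x : E²} (hx : x ∉ K) :
    P.flux Z i j =ᶠ[𝓝 x] fun _ => 0 := by
  filter_upwards [hKc.isClosed.isOpen_compl.mem_nhds hx] with y hy
    using P.flux_eq_zero hK hKU i j hy

theorem contDiff_flux (hZ : ContDiff ℝ 1 Z) (hKc : IsCompact K) (hK : M ∩ tsupport Z ⊆ P.S '' K)
    (hKU : K ⊆ P.U) {i j : Fin 2} (hij : i ≠ j) : ContDiff ℝ 1 (P.flux Z i j) := by
  refine contDiff_iff_contDiffAt.2 fun x => ?_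
  by_cases hx : x ∈ P.U
  · exact ((P.contDiffOn_flux hZ hij).contDiffAt (P.isOpen_U.mem_nhds hx)).congr_of_eventuallyEq
      (P.flux_eventuallyEq i j hx)
  · exact contDiffAt_const.congr_of_eventuallyEq
      (P.flux_eventuallyEq_zero hKc hK hKU i j fun h => hx (hKU h))

/-- The coordinate formula `√g div Z = ∂₀(√g z⁰) + ∂₁(√g z¹)`. -/
theorem sqrt_gram_mul_surfaceDiv (hZ : ContDiff ℝ 1 Z) (hT : ∀ q ∈ M, Z q ∈ tangentPlane M q)
    {x : E²} (hx : x ∈ P.U) :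
    √(P.gram x) * surfaceDiv M Z (P.S x)
      = fderiv ℝ (P.flux Z 0 1) x (EuclideanSpace.single 0 1)
        + fderiv ℝ (P.flux Z 1 0) x (EuclideanSpace.single 1 1) := by
  have hZS : HasFDerivAt (fun y => Z (P.S y)) (fderiv ℝ Z (P.S x) ∘L fderiv ℝ P.S x) x :=
    (hZ.differentiable (by simp) _).hasFDerivAt.comp x (P.differentiableAt hx).hasFDerivAt
  have h := fderiv_sqrt_gramDet_mul_gramCoord_add (Y := fun y => Z (P.S y))
    (P.differentiableAt_coordVec 0 hx)
    (P.differentiableAt_coordVec 1 hx) hZS.differentiableAt (P.gram_pos hx)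
    (P.fderiv_coordVec_comm hx) (by
      filter_upwards [P.isOpen_U.mem_nhds hx] with y hy
      exact ⟨P.gram_pos hy, (P.tangentPlane_eq hy).le (hT _ (P.mem hy))⟩)
  rw [(P.flux_eventuallyEq 0 1 hx).fderiv_eq, (P.flux_eventuallyEq 1 0 hx).fderiv_eq,
    P.surfaceDiv_apply Z hx]
  refine Eq.trans ?_ h.symm
  rw [hZS.fderiv]
  rfl

theorem fderiv_flux_eq_zero (hKc : IsCompact K) (hK : M ∩ tsupport Z ⊆ P.S '' K)
    (hKU : K ⊆ P.U) (i j : Fin 2) {x : E²} (hx : x ∉ P.U) : fderiv ℝ (P.flux Z i j) x = 0 := by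
  rw [(P.flux_eventuallyEq_zero hKc hK hKU i j fun h => hx (hKU h)).fderiv_eq]
  simp

theorem surfaceDiv_eq_zero {q : E³} (hq : q ∉ tsupport Z) : surfaceDiv M Z q = 0 := by
  simp [surfaceDiv, fderiv_of_notMem_tsupport (𝕜 := ℝ) hq]

theorem surfaceDiv_eq_zero_of_notMem_patch (hK : M ∩ tsupport Z ⊆ P.S '' K) (hKU : K ⊆ P.U)
    {q : E³} (hqM : q ∈ M) (hq : q ∉ P.patch) : surfaceDiv M Z q = 0 :=
  surfaceDiv_eq_zero fun h => hq (image_mono hKU (hK ⟨hqM, h⟩))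

theorem integrable_surfaceDiv (hM : MeasurableSet M) (hZ : ContDiff ℝ 1 Z)
    (hT : ∀ q ∈ M, Z q ∈ tangentPlane M q) (hKc : IsCompact K)
    (hK : M ∩ tsupport Z ⊆ P.S '' K) (hKU : K ⊆ P.U) :
    Integrable (surfaceDiv M Z) (areaMeasure M) := by
  refine P.integrable_areaMeasure hM
    (fun q hqM hq => P.surfaceDiv_eq_zero_of_notMem_patch hK hKU hqM hq) ?_
  refine IntegrableOn.congr_fun ?_ (fun x hx => (P.sqrt_gram_mul_surfaceDiv hZ hT hx).symm)
    P.isOpen_U.measurableSet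
  have hC := P.hasCompactSupport_flux hKc hK hKU
  exact ((integrable_fderiv_apply (P.contDiff_flux hZ hKc hK hKU (by simp)) (hC 0 1) _).add
    (integrable_fderiv_apply (P.contDiff_flux hZ hKc hK hKU (by simp)) (hC 1 0) _)).integrableOn

theorem flux_one_zero_eq (Z : E³ → E³) : P.flux Z 1 0 = P.U.indicator fun x =>
    inner ℝ (Z (P.S x)) (P.conormal x) * ‖P.coordVec 0 x‖ := by
  refine indicator_congr fun x hx => ?_
  exact (norm_mul_inner_gramNormal (P.coordVec_ne_zero hx 0) (P.gram_pos hx) _).symm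

/-- **Gauss–Green formula** on `C`, for a field supported in an adapted patch. -/
theorem integral_indicator_mul_surfaceDiv {C : Set E³} (hPC : P.IsAdapted C)
    (hM : MeasurableSet M) (hZ : ContDiff ℝ 1 Z) (hT : ∀ q ∈ M, Z q ∈ tangentPlane M q)
    (hKc : IsCompact K) (hK : M ∩ tsupport Z ⊆ P.S '' K) (hKU : K ⊆ P.U) :
    ∫ q, C.indicator 1 q * surfaceDiv M Z q ∂areaMeasure M
      = -∫ s, P.U.indicator (fun x => inner ℝ (Z (P.S x)) (P.conormal x) * ‖P.coordVec 0 x‖)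
          (planePoint (s, 0)) := by
  have hU := P.isOpen_U.measurableSet
  have hH : MeasurableSet {x : E² | 0 < x 1} :=
    measurableSet_lt measurable_const (by fun_prop)
  have hC := P.hasCompactSupport_flux hKc hK hKU
  have hF0 := P.contDiff_flux hZ hKc hK hKU (i := 0) (j := 1) (by simp)
  have hF1 := P.contDiff_flux hZ hKc hK hKU (i := 1) (j := 0) (by simp)
  have hsum : ∫ x in {x : E² | 0 < x 1}, (fderiv ℝ (P.flux Z 0 1) x (EuclideanSpace.single 0 1)
      + fderiv ℝ (P.flux Z 1 0) x (EuclideanSpace.single 1 1))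
      = -∫ s, P.flux Z 1 0 (planePoint (s, 0)) := by
    rw [integral_add (integrable_fderiv_apply hF0 (hC 0 1) _).integrableOn
        (integrable_fderiv_apply hF1 (hC 1 0) _).integrableOn,
      setIntegral_halfPlane_fderiv_zero hF0 (hC 0 1),
      setIntegral_halfPlane_fderiv_one hF1 (hC 1 0), zero_add]
  rw [← P.flux_one_zero_eq, ← hsum,
    P.integral_areaMeasure hM fun q hqM hq => by
      rw [P.surfaceDiv_eq_zero_of_notMem_patch hK hKU hqM hq, mul_zero],
    ← integral_indicator hU, ← integral_indicator hH]
  refine integral_congr_ae ?_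
  filter_upwards [ae_apply_one_ne_zero] with x hx1
  by_cases hx : x ∈ P.U
  · rw [indicator_of_mem hx]
    rcases hx1.lt_or_gt with h | h
    · rw [indicator_of_notMem ((hPC x hx).2 h), indicator_of_notMem (by simpa using h.le)]
      simp
    · rw [indicator_of_mem ((hPC x hx).1 h), indicator_of_mem (by simpa using h),
        ← P.sqrt_gram_mul_surfaceDiv hZ hT hx, Pi.one_apply, one_mul]
  · rw [indicator_of_notMem hx]
    simp [indicator, P.fderiv_flux_eq_zero hKc hK hKU _ _ hx]

end Flux

end LocalParam

/-! ### Adapted parametrizations and the conormal of the boundary -/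

namespace LocalParam

variable {M C : Set E³}

/-- The parametrization `x ↦ S (x + v)`, restricted to the parameters with `x + v ∈ W`. -/
def translate (P : LocalParam M) (v : E²) (W : Set E²) (hW : IsOpen W) (hWU : W ⊆ P.U) :
    LocalParam M where
  U := (fun x => x + v) ⁻¹' W
  S := fun x => P.S (x + v)
  isOpen_U := hW.preimage (by fun_prop)
  contDiffOn := P.contDiffOn.comp (by fun_prop) fun _ hx => hWU hx
  injOn := fun _ hx _ hy h => add_right_cancel (P.injOn (hWU hx) (hWU hy) h)
  injective_fderiv := fun x hx => by
    rw [fderiv_comp_add_right]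
    exact P.injective_fderiv _ (hWU hx)
  image_open := fun Y hY hYo => by
    obtain ⟨O, hO, h⟩ := P.image_open ((fun x => x + v) '' Y)
      ((image_subset_iff.2 hY).trans hWU) ((Homeomorph.addRight v).isOpenMap _ hYo)
    exact ⟨O, hO, by rw [← h, image_image]⟩

theorem isOpen_inter_preimage (P : LocalParam M) {O : Set E³} (hO : IsOpen O) :
    IsOpen (P.U ∩ P.S ⁻¹' O) :=
  P.continuousOn.isOpen_inter_preimage P.isOpen_U hO

/-- Around boundary points adapted parametrizations exist by hypothesis; elsewhere any sufficiently
small patch lies in `C` or in its complement, and is moved into the matching half plane. -/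
theorem exists_isAdapted (hM : IsClosedSurface M) (hbd : HasSmoothBoundary M C)
    {p : E³} (hp : p ∈ M) : ∃ P : LocalParam M, p ∈ P.patch ∧ P.IsAdapted C := by
  by_cases hpb : p ∈ relBoundary M C
  · exact hbd p hpb
  obtain ⟨P, x₀, hx₀, rfl⟩ := hM.exists_param p hp
  -- A small patch avoiding `F`, translated so that the second parameter is close to `c`.
  have key : ∀ F : Set E³, IsClosed F → P.S x₀ ∉ F → ∀ c : ℝ, ∃ Q : LocalParam M,
      P.S x₀ ∈ Q.patch ∧ ∀ x ∈ Q.U, Q.S x ∉ F ∧ |x 1 - c| < 1 := by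
    intro F hF hx₀F c
    let W : Set E² := (P.U ∩ P.S ⁻¹' Fᶜ) ∩ {x | |x 1 - x₀ 1| < 1}
    have hW : IsOpen W := (P.isOpen_inter_preimage hF.isOpen_compl).inter
      (isOpen_lt (by fun_prop) continuous_const)
    let v : E² := (x₀ 1 - c) • EuclideanSpace.single 1 1
    refine ⟨P.translate v W hW fun x hx => hx.1.1, ⟨x₀ - v, ?_, ?_⟩, fun x hx => ⟨?_, ?_⟩⟩
    · have : x₀ ∈ W := ⟨⟨hx₀, hx₀F⟩, by simp⟩
      simpa [translate] using this
    · simp [translate]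
    · exact hx.1.2
    · have := hx.2
      simp only [mem_ofPred_eq, PiLp.add_apply, v, PiLp.smul_apply, PiLp.single_apply, if_true,
        smul_eq_mul, mul_one] at this
      rwa [show x 1 + (x₀ 1 - c) - x₀ 1 = x 1 - c by ring] at this
  rcases not_and_or.1 hpb with h | h
  · obtain ⟨Q, hQ, hQx⟩ := key _ isClosed_closure h (-1)
    refine ⟨Q, hQ, fun x hx => ⟨fun h0 => ?_, fun _ hC => (hQx x hx).1 (subset_closure hC)⟩⟩
    have := (abs_lt.1 (hQx x hx).2).2
    linarith
  · obtain ⟨Q, hQ, hQx⟩ := key _ isClosed_closure h 1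
    refine ⟨Q, hQ, fun x hx => ⟨fun _ => ?_, fun h0 => ?_⟩⟩
    · by_contra hC
      exact (hQx x hx).1 (subset_closure ⟨Q.mem hx, hC⟩)
    · have := (abs_lt.1 (hQx x hx).2).1
      linarith

theorem eventually_mem_line (P : LocalParam M) {x : E²} (hx : x ∈ P.U) (v : E²) :
    ∀ᶠ t in 𝓝 (0 : ℝ), x + t • v ∈ P.U := by
  have hc : ContinuousAt (fun t : ℝ => x + t • v) 0 := by fun_prop
  exact hc.eventually_mem (P.isOpen_U.mem_nhds (by simpa using hx))

/-- In an adapted parametrization the boundary is exactly the line `{x₁ = 0}`. -/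
theorem IsAdapted.mem_relBoundary_iff (hCM : C ⊆ M) {P : LocalParam M} (hP : P.IsAdapted C)
    {x : E²} (hx : x ∈ P.U) : P.S x ∈ relBoundary M C ↔ x 1 = 0 := by
  have hcont : ∀ v : E², Filter.Tendsto (fun t : ℝ => P.S (x + t • v)) (𝓝 0) (𝓝 (P.S x)) := by
    intro v
    have h0 : ContinuousAt P.S (x + (0 : ℝ) • v) := by
      rw [zero_smul, add_zero]; exact (P.differentiableAt hx).continuousAt
    have hl : ContinuousAt (fun t : ℝ => x + t • v) 0 := by fun_prop
    have := ContinuousAt.comp (f := fun t : ℝ => x + t • v) h0 hl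
    simpa [ContinuousAt, Function.comp_def] using this
  constructor
  · rintro ⟨h1, h2⟩
    rcases lt_trichotomy (x 1) 0 with h | h | h
    · obtain ⟨O, hO, hOM⟩ := P.image_open (P.U ∩ {y | y 1 < 0}) inter_subset_left
        (P.isOpen_U.inter (isOpen_lt (by fun_prop) continuous_const))
      obtain ⟨q, hqO, hqC⟩ := mem_closure_iff.1 h1 O hO
        (hOM.subset (mem_image_of_mem _ ⟨hx, h⟩)).2
      obtain ⟨y, hy, rfl⟩ := hOM.symm.subset ⟨hCM hqC, hqO⟩
      exact absurd hqC ((hP y hy.1).2 hy.2)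
    · exact h
    · obtain ⟨O, hO, hOM⟩ := P.image_open (P.U ∩ {y | 0 < y 1}) inter_subset_left
        (P.isOpen_U.inter (isOpen_lt continuous_const (by fun_prop)))
      obtain ⟨q, hqO, hqC⟩ := mem_closure_iff.1 h2 O hO
        (hOM.subset (mem_image_of_mem _ ⟨hx, h⟩)).2
      obtain ⟨y, hy, rfl⟩ := hOM.symm.subset ⟨hqC.1, hqO⟩
      exact absurd ((hP y hy.1).1 hy.2) hqC.2
  · intro h
    constructor
    · refine mem_closure_of_tendsto ((hcont (EuclideanSpace.single 1 1)).mono_left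
        (nhdsWithin_le_nhds (s := Ioi 0))) ?_
      filter_upwards [mem_nhdsWithin_of_mem_nhds (P.eventually_mem_line hx _), self_mem_nhdsWithin]
        with t ht ht0
      exact (hP _ ht).1 (by simpa [h] using ht0)
    · refine mem_closure_of_tendsto ((hcont (EuclideanSpace.single 1 1)).mono_left
        (nhdsWithin_le_nhds (s := Iio 0))) ?_
      filter_upwards [mem_nhdsWithin_of_mem_nhds (P.eventually_mem_line hx _), self_mem_nhdsWithin]
        with t ht ht0
      exact ⟨P.mem ht, (hP _ ht).2 (by simpa [h] using ht0)⟩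

/-- At a boundary point the conormal does not depend on the adapted parametrization: the change of
coordinates maps the line `{x₁ = 0}` to itself and the half plane `{x₁ > 0}` to itself, so that its
differential is triangular with a positive last entry. -/
theorem IsAdapted.conormal_eq (hCM : C ⊆ M) {P Q : LocalParam M} (hP : P.IsAdapted C)
    (hQ : Q.IsAdapted C) {x y : E²} (hx : x ∈ Q.U) (hy : y ∈ P.U) (hxy : P.S y = Q.S x)
    (hx1 : x 1 = 0) : P.conormal y = Q.conormal x := by
  obtain ⟨τ, hτx, hτd, hτ, hfd⟩ := P.exists_transition Q hx hy hxy
  have hline : ∀ v : E², HasDerivAt (fun t : ℝ => τ (x + t • v) 1) (fderiv ℝ τ x v 1) 0 := by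
    intro v
    have h1 : HasDerivAt (fun t : ℝ => x + t • v) v 0 := by
      simpa using ((hasDerivAt_id (0 : ℝ)).smul_const v).const_add x
    have h2 : HasFDerivAt τ (fderiv ℝ τ x) (x + (0 : ℝ) • v) := by
      rw [zero_smul, add_zero]; exact hτd.hasFDerivAt
    exact (PiLp.hasFDerivAt_apply (𝕜 := ℝ) 2 _ (1 : Fin 2)).comp_hasDerivAt (0 : ℝ)
      (h2.comp_hasDerivAt (0 : ℝ) h1)
  have hev : ∀ v : E², ∀ᶠ t in 𝓝 (0 : ℝ), x + t • v ∈ Q.U ∧ τ (x + t • v) ∈ P.U ∧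
      P.S (τ (x + t • v)) = Q.S (x + t • v) := by
    intro v
    have hc : ContinuousAt (fun t : ℝ => x + t • v) 0 := by fun_prop
    have hτ' : ∀ᶠ z in 𝓝 (x + (0 : ℝ) • v), τ z ∈ P.U ∧ P.S (τ z) = Q.S z := by
      rwa [zero_smul, add_zero]
    exact (Q.eventually_mem_line hx v).and (hc.eventually hτ')
  have hbdy : ∀ z ∈ Q.U, τ z ∈ P.U → P.S (τ z) = Q.S z → (τ z 1 = 0 ↔ z 1 = 0) := by
    intro z hz hzP h
    rw [← hP.mem_relBoundary_iff hCM hzP, h, hQ.mem_relBoundary_iff hCM hz]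
  have h01 : fderiv ℝ τ x (EuclideanSpace.single 0 1) 1 = 0 := by
    refine (hline _).unique ((hasDerivAt_const (0 : ℝ) (0 : ℝ)).congr_of_eventuallyEq ?_)
    filter_upwards [hev (EuclideanSpace.single 0 1)] with t ht
    exact (hbdy _ ht.1 ht.2.1 ht.2.2).2 (by simp [hx1])
  have h11 : 0 ≤ fderiv ℝ τ x (EuclideanSpace.single 1 1) 1 := by
    refine ge_of_tendsto (hline (EuclideanSpace.single 1 1)).tendsto_slope_zero_right ?_
    filter_upwards [mem_nhdsWithin_of_mem_nhds (hev (EuclideanSpace.single 1 1)),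
      self_mem_nhdsWithin] with t ht ht0
    have ht0' : (0 : ℝ) < t := ht0
    have hzero : τ x 1 = 0 := by
      rw [hτx, ← hP.mem_relBoundary_iff hCM hy, hxy, hQ.mem_relBoundary_iff hCM hx, hx1]
    have hpos : 0 ≤ τ (x + t • EuclideanSpace.single 1 1) 1 := by
      by_contra hneg
      refine (hP _ ht.2.1).2 (not_le.1 hneg) ?_
      rw [ht.2.2]
      exact (hQ _ ht.1).1 (by simpa [hx1] using ht0')
    simp only [zero_add, zero_smul, add_zero, hzero, sub_zero, smul_eq_mul]
    positivity
  have hv : ∀ i, Q.coordVec i x = fderiv ℝ τ x (EuclideanSpace.single i 1) 0 • P.coordVec 0 y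
      + fderiv ℝ τ x (EuclideanSpace.single i 1) 1 • P.coordVec 1 y := by
    intro i
    rw [coordVec, hfd, ContinuousLinearMap.comp_apply, P.fderiv_apply]
  have hv0 : Q.coordVec 0 x = fderiv ℝ τ x (EuclideanSpace.single 0 1) 0 • P.coordVec 0 y := by
    rw [hv 0, h01, zero_smul, add_zero]
  have hc : fderiv ℝ τ x (EuclideanSpace.single 0 1) 0 ≠ 0 := by
    intro h
    exact Q.coordVec_ne_zero hx 0 (by rw [hv0, h, zero_smul])
  have hd : fderiv ℝ τ x (EuclideanSpace.single 1 1) 1 ≠ 0 := by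
    intro h
    have hg := Q.gram_pos hx
    rw [gram, hv0, hv 1, h, zero_smul, add_zero] at hg
    simp only [gramDet, real_inner_smul_left, real_inner_smul_right] at hg
    exact absurd hg (by ring_nf; exact lt_irrefl _)
  rw [conormal, conormal, hv0, hv 1, gramNormal_change (P.coordVec_ne_zero hy 0) hc
    (lt_of_le_of_ne h11 hd.symm)]

theorem contDiffOn_conormal (P : LocalParam M) :
    ContDiffOn ℝ 1 P.conormal P.U := by
  have hc : ∀ j, ContDiffOn ℝ 1 (P.coordVec j) P.U := fun j =>
    (P.contDiffOn_coordVec j).of_le (by simp)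
  have hs : ContDiffOn ℝ 1 (fun x => ‖P.coordVec 0 x‖ / √(P.gram x)) P.U :=
    ((hc 0).norm ℝ fun x hx => P.coordVec_ne_zero hx 0).div
      ((P.contDiffOn_gram.of_le (by simp)).sqrt fun x hx => (P.gram_pos hx).ne')
      fun x hx => (Real.sqrt_pos.2 (P.gram_pos hx)).ne'
  have hr : ContDiffOn ℝ 1 (fun x => inner ℝ (P.coordVec 0 x) (P.coordVec 1 x)
      / inner ℝ (P.coordVec 0 x) (P.coordVec 0 x)) P.U :=
    ((hc 0).inner ℝ (hc 1)).div ((hc 0).inner ℝ (hc 0)) fun x hx =>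
      inner_self_ne_zero.2 (P.coordVec_ne_zero hx 0)
  exact hs.smul ((hc 1).sub (hr.smul (hc 0)))

end LocalParam

/-! ### Integrals along the boundary curves -/

theorem relBoundary_subset {M C : Set E³} (hM : IsClosed M) (hCM : C ⊆ M) :
    relBoundary M C ⊆ M :=
  inter_subset_left.trans (closure_minimal hCM hM)

namespace BoundaryParam

variable {M C : Set E³} (Γ : BoundaryParam M C)

theorem mem_relBoundary {i : Fin Γ.n} {t : ℝ} (ht : t ∈ Ico (Γ.a i) (Γ.b i)) :
    Γ.γ i t ∈ relBoundary M C :=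
  Γ.bijOn.mapsTo (x := ⟨i, t⟩) ht

theorem differentiableAt {i : Fin Γ.n} {t : ℝ} (ht : t ∈ Ioo (Γ.a i) (Γ.b i)) :
    DifferentiableAt ℝ (Γ.γ i) t :=
  ((Γ.contDiffOn i).contDiffAt (Icc_mem_nhds ht.1 ht.2)).differentiableAt (by simp)

theorem integrableOn_mul_norm_deriv {f : E³ → ℝ} (hf : Continuous f) (i : Fin Γ.n) :
    IntegrableOn (fun t => f (Γ.γ i t) * ‖deriv (Γ.γ i) t‖) (Ioo (Γ.a i) (Γ.b i)) := by
  have hc : ContinuousOn (fun t => f (Γ.γ i t) *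
      ‖derivWithin (Γ.γ i) (Icc (Γ.a i) (Γ.b i)) t‖) (Icc (Γ.a i) (Γ.b i)) :=
    (hf.comp_continuousOn (Γ.contDiffOn i).continuousOn).mul
      ((Γ.contDiffOn i).continuousOn_derivWithin (uniqueDiffOn_Icc (Γ.lt i)) le_rfl).norm
  refine ((hc.integrableOn_compact isCompact_Icc).mono_set Ioo_subset_Icc_self).congr_fun
    (fun t ht => ?_) measurableSet_Ioo
  simp only
  rw [derivWithin_of_mem_nhds (Icc_mem_nhds ht.1 ht.2)]

theorem intervalIntegral_eq (i : Fin Γ.n) (g : ℝ → ℝ) :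
    ∫ t in Γ.a i..Γ.b i, g t = ∫ t in Ioo (Γ.a i) (Γ.b i), g t := by
  rw [intervalIntegral.integral_of_le (Γ.lt i).le, integral_Ioc_eq_integral_Ioo]

section Coordinate

variable {P : LocalParam M} {O : Set E³} {φ : E³ → E²}

/-- The parameters at which a boundary curve runs through the open set `O`. -/
def coordSet (O : Set E³) (i : Fin Γ.n) : Set ℝ := Ioo (Γ.a i) (Γ.b i) ∩ Γ.γ i ⁻¹' O

/-- The first coordinate of a boundary curve in a parametrization with local inverse `φ`. -/
def coord (φ : E³ → E²) (i : Fin Γ.n) (t : ℝ) : ℝ := φ (Γ.γ i t) 0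

theorem isOpen_coordSet (hO : IsOpen O) (i : Fin Γ.n) : IsOpen (Γ.coordSet O i) :=
  ((Γ.contDiffOn i).continuousOn.mono Ioo_subset_Icc_self).isOpen_inter_preimage isOpen_Ioo hO

theorem planePoint_coord (hM : IsClosed M) (hCM : C ⊆ M) (hP : P.IsAdapted C)
    (hφ : P.IsLocalInverse O φ) {i : Fin Γ.n} {t : ℝ} (ht : t ∈ Ico (Γ.a i) (Γ.b i))
    (htO : Γ.γ i t ∈ O) :
    planePoint (Γ.coord φ i t, 0) = φ (Γ.γ i t) ∧ φ (Γ.γ i t) ∈ P.U ∧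
      P.S (φ (Γ.γ i t)) = Γ.γ i t ∧ φ (Γ.γ i t) 1 = 0 := by
  have hb := Γ.mem_relBoundary ht
  have hU := hφ.mapsTo htO
  have hS := hφ.right_inv _ ⟨relBoundary_subset hM hCM hb, htO⟩
  have h1 : φ (Γ.γ i t) 1 = 0 := by
    rw [← hP.mem_relBoundary_iff hCM hU, hS]
    exact hb
  exact ⟨planePoint_eq_self h1, hU, hS, h1⟩

theorem hasDerivAt_coord (hM : IsClosed M) (hCM : C ⊆ M) (hP : P.IsAdapted C)
    (hφ : P.IsLocalInverse O φ) {i : Fin Γ.n} {t : ℝ} (ht : t ∈ Γ.coordSet O i) :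
    HasDerivAt (Γ.coord φ i) (deriv (Γ.coord φ i) t) t ∧
      ‖deriv (Γ.γ i) t‖ = |deriv (Γ.coord φ i) t| * ‖P.coordVec 0 (φ (Γ.γ i t))‖ := by
  have hγ := (Γ.differentiableAt ht.1).hasDerivAt
  have hφd : DifferentiableAt ℝ φ (Γ.γ i t) :=
    (hφ.contDiffOn.contDiffAt (hφ.isOpen.mem_nhds ht.2)).differentiableAt (by simp)
  set v := fderiv ℝ φ (Γ.γ i t) (deriv (Γ.γ i) t)
  have hv : HasDerivAt (fun t => φ (Γ.γ i t)) v t := hφd.hasFDerivAt.comp_hasDerivAt t hγ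
  have hvj : ∀ j : Fin 2, HasDerivAt (fun t => φ (Γ.γ i t) j) (v j) t := fun j =>
    (EuclideanSpace.proj j : E² →L[ℝ] ℝ).hasFDerivAt.comp_hasDerivAt t hv
  have hloc : ∀ᶠ r in 𝓝 t, r ∈ Γ.coordSet O i := (Γ.isOpen_coordSet hφ.isOpen i).mem_nhds ht
  have hpt := fun r (hr : r ∈ Γ.coordSet O i) =>
    Γ.planePoint_coord hM hCM hP hφ (Ioo_subset_Ico_self hr.1) hr.2
  have hv1 : v 1 = 0 :=
    (hvj 1).unique ((hasDerivAt_const t (0 : ℝ)).congr_of_eventuallyEq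
      (hloc.mono fun r hr => (hpt r hr).2.2.2))
  have hS : HasDerivAt (Γ.γ i) (fderiv ℝ P.S (φ (Γ.γ i t)) v) t :=
    ((P.differentiableAt (hpt t ht).2.1).hasFDerivAt.comp_hasDerivAt t hv).congr_of_eventuallyEq
      (hloc.mono fun r hr => (hpt r hr).2.2.1.symm)
  have h0 : HasDerivAt (Γ.coord φ i) (v 0) t := hvj 0
  rw [hS.deriv, h0.deriv, P.fderiv_apply, hv1, zero_smul, add_zero, norm_smul, Real.norm_eq_abs]
  exact ⟨h0, rfl⟩

theorem coord_injective (hM : IsClosed M) (hCM : C ⊆ M) (hP : P.IsAdapted C)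
    (hφ : P.IsLocalInverse O φ) {i j : Fin Γ.n} {t r : ℝ} (ht : t ∈ Γ.coordSet O i)
    (hr : r ∈ Γ.coordSet O j) (h : Γ.coord φ i t = Γ.coord φ j r) :
    (⟨i, t⟩ : (_ : Fin Γ.n) × ℝ) = ⟨j, r⟩ := by
  obtain ⟨h1, -, h2, -⟩ := Γ.planePoint_coord hM hCM hP hφ (Ioo_subset_Ico_self ht.1) ht.2
  obtain ⟨h3, -, h4, -⟩ := Γ.planePoint_coord hM hCM hP hφ (Ioo_subset_Ico_self hr.1) hr.2
  refine Γ.bijOn.injOn (Ioo_subset_Ico_self ht.1) (Ioo_subset_Ico_self hr.1) ?_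
  change Γ.γ i t = Γ.γ j r
  rw [← h2, ← h4, ← h1, ← h3, h]

/-- The boundary integral over an adapted patch is the sum of the integrals along the boundary
curves. In the coordinate along the line `{x₁ = 0}` each curve is an injective function of one
variable, and these functions together cover the line up to finitely many points, so that the
formula is the change of variables in one dimension. -/
theorem integral_line_eq_sum (hM : IsClosed M) (hCM : C ⊆ M) (hP : P.IsAdapted C)
    (hφ : P.IsLocalInverse O φ) {f : E³ → ℝ} (hf : Continuous f) (hfO : ∀ q, q ∉ O → f q = 0) :
    ∫ s, P.U.indicator (fun x => f (P.S x) * ‖P.coordVec 0 x‖) (planePoint (s, 0))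
      = ∑ i, ∫ t in Γ.a i..Γ.b i, f (Γ.γ i t) * ‖deriv (Γ.γ i) t‖ := by
  set G : ℝ → ℝ := fun s =>
    P.U.indicator (fun x => f (P.S x) * ‖P.coordVec 0 x‖) (planePoint (s, 0)) with hG
  have hd := fun i t (ht : t ∈ Γ.coordSet O i) => Γ.hasDerivAt_coord hM hCM hP hφ ht
  have hinj : ∀ i, InjOn (Γ.coord φ i) (Γ.coordSet O i) := fun i t ht r hr h => by
    simpa using Γ.coord_injective hM hCM hP hφ ht hr h
  have hmT : ∀ i, MeasurableSet (Γ.coordSet O i) := fun i =>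
    (Γ.isOpen_coordSet hφ.isOpen i).measurableSet
  have hGσ : ∀ i, ∀ t ∈ Γ.coordSet O i, |deriv (Γ.coord φ i) t| • G (Γ.coord φ i t)
      = f (Γ.γ i t) * ‖deriv (Γ.γ i) t‖ := by
    intro i t ht
    obtain ⟨h1, h2, h3, -⟩ := Γ.planePoint_coord hM hCM hP hφ (Ioo_subset_Ico_self ht.1) ht.2
    rw [(hd i t ht).2, hG]
    simp only
    rw [h1, indicator_of_mem h2, h3, smul_eq_mul]
    ring
  have hint : ∀ i, IntegrableOn G (Γ.coord φ i '' Γ.coordSet O i) := by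
    intro i
    rw [integrableOn_image_iff_integrableOn_abs_deriv_smul (hmT i)
      (fun t ht => (hd i t ht).1.hasDerivWithinAt) (hinj i)]
    exact ((Γ.integrableOn_mul_norm_deriv hf i).mono_set inter_subset_left).congr_fun
      (fun t ht => (hGσ i t ht).symm) (hmT i)
  have hmI : ∀ i, MeasurableSet (Γ.coord φ i '' Γ.coordSet O i) := fun i =>
    (hmT i).image_of_continuousOn_injOn
      (fun t ht => (hd i t ht).1.continuousAt.continuousWithinAt) (hinj i)
  have hdisj : Pairwise (Function.onFun Disjoint fun i => Γ.coord φ i '' Γ.coordSet O i) := by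
    intro i j hij
    refine Set.disjoint_left.2 ?_
    rintro _ ⟨t, ht, rfl⟩ ⟨r, hr, h⟩
    exact hij (congrArg Sigma.fst (Γ.coord_injective hM hCM hP hφ ht hr h.symm))
  have hzero : ∀ᵐ s, s ∉ ⋃ i, Γ.coord φ i '' Γ.coordSet O i → G s = 0 := by
    -- The exceptional points are the coordinates of the initial points of the curves.
    have hfin : (range fun i => Γ.coord φ i (Γ.a i)).Finite := finite_range _
    filter_upwards [hfin.countable.ae_notMem volume] with s hs hsU
    by_contra hne
    have hxU : planePoint (s, 0) ∈ P.U := by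
      by_contra h
      exact hne (indicator_of_notMem h _)
    have hxO : P.S (planePoint (s, 0)) ∈ O := by
      by_contra h
      exact hne (by rw [hG]; simp only; rw [indicator_of_mem hxU, hfO _ h, zero_mul])
    have hb : P.S (planePoint (s, 0)) ∈ relBoundary M C := by
      rw [hP.mem_relBoundary_iff hCM hxU]
      rfl
    obtain ⟨⟨i, t⟩, ht, hit⟩ := Γ.bijOn.surjOn hb
    have hit' : Γ.γ i t = P.S (planePoint (s, 0)) := hit
    have ht' : t ∈ Ico (Γ.a i) (Γ.b i) := ht
    have hcs : Γ.coord φ i t = s := by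
      rw [coord, hit', hφ.left_inv hxU hxO, planePoint_apply_zero]
    rcases eq_or_lt_of_le ht'.1 with h | h
    · exact hs ⟨i, by rw [← hcs, ← h]⟩
    · exact hsU (mem_iUnion.2 ⟨i, t, ⟨⟨h, ht'.2⟩, by rw [mem_preimage, hit']; exact hxO⟩, hcs⟩)
  rw [← setIntegral_eq_integral_of_ae_compl_eq_zero hzero, integral_iUnion_fintype hmI hdisj hint]
  refine Finset.sum_congr rfl fun i _ => ?_
  rw [integral_image_eq_integral_abs_deriv_smul (hmT i)
      (fun t ht => (hd i t ht).1.hasDerivWithinAt) (hinj i), Γ.intervalIntegral_eq,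
    setIntegral_congr_fun (hmT i) (hGσ i)]
  refine (setIntegral_eq_of_subset_of_forall_sdiff_eq_zero measurableSet_Ioo inter_subset_left
    ?_).symm
  intro t ht
  rw [hfO _ fun h => ht.2 ⟨ht.1, h⟩, zero_mul]

end Coordinate

end BoundaryParam

/-! ### Gauss–Green on the surface -/

/-- Finitely many adapted parametrizations of `M` with local inverses, and a partition of unity
subordinate to their domains. The functions add up to one not only on `M` but near `M`, so that they
do not affect derivatives in the ambient space. -/
structure AdaptedPartition (M C : Set E³) where
  ι : Type
  fintype : Fintype ι
  chart : ι → LocalParam M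
  O : ι → Set E³
  φ : ι → E³ → E²
  χ : ι → E³ → ℝ
  isAdapted : ∀ i, (chart i).IsAdapted C
  isLocalInverse : ∀ i, (chart i).IsLocalInverse (O i) (φ i)
  contDiff : ∀ i, ContDiff ℝ 1 (χ i)
  nonneg : ∀ i q, 0 ≤ χ i q
  tsupport_subset : ∀ i, tsupport (χ i) ⊆ O i
  sum_eventually_eq_one : ∀ q ∈ M, ∀ᶠ r in 𝓝 q, ∑ i, χ i r = 1

attribute [instance] AdaptedPartition.fintype

open scoped Manifold in
theorem exists_adaptedPartition {M C : Set E³} (hM : IsClosedSurface M)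
    (hbd : HasSmoothBoundary M C) : Nonempty (AdaptedPartition M C) := by
  have hex : ∀ p : M, ∃ (P : LocalParam M) (O : Set E³) (φ : E³ → E²), (p : E³) ∈ O ∧
      P.IsAdapted C ∧ P.IsLocalInverse O φ := by
    rintro ⟨p, hp⟩
    obtain ⟨P, ⟨x, hx, rfl⟩, hP⟩ := LocalParam.exists_isAdapted hM hbd hp
    obtain ⟨O, φ, hO, hφ⟩ := P.exists_isLocalInverse hx
    exact ⟨P, O, φ, hO, hP, hφ⟩
  choose P O φ hpO hP hφ using hex
  obtain ⟨t, ht⟩ := hM.isCompact.elim_finite_subcover O (fun p => (hφ p).isOpen)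
    fun p hp => mem_iUnion.2 ⟨⟨p, hp⟩, hpO ⟨p, hp⟩⟩
  have ht' : M ⊆ ⋃ i : t, O i := fun q hq => by
    obtain ⟨i, hi, hqi⟩ := mem_iUnion₂.1 (ht hq)
    exact mem_iUnion.2 ⟨⟨i, hi⟩, hqi⟩
  obtain ⟨L, hL, hML, hLO⟩ := exists_compact_between hM.isCompact
    (isOpen_iUnion fun i : t => (hφ i).isOpen) ht'
  obtain ⟨f, hf⟩ := SmoothPartitionOfUnity.exists_isSubordinate 𝓘(ℝ, E³) hL.isClosed
    (fun i : t => O i) (fun i => (hφ i).isOpen) hLO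
  let ψ : Fin (Fintype.card t) ≃ t := (Fintype.equivFin t).symm
  exact ⟨{
    ι := Fin (Fintype.card t)
    fintype := inferInstance
    chart := fun i => P (ψ i)
    O := fun i => O (ψ i)
    φ := fun i => φ (ψ i)
    χ := fun i => f (ψ i)
    isAdapted := fun i => hP _
    isLocalInverse := fun i => hφ _
    contDiff := fun i => (f (ψ i)).contMDiff.contDiff.of_le (by simp)
    nonneg := fun i q => f.nonneg _ q
    tsupport_subset := fun i => hf _
    sum_eventually_eq_one := fun q hq => by
      filter_upwards [mem_interior_iff_mem_nhds.1 (hML hq)] with r hr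
      rw [Equiv.sum_comp ψ fun i => f i r, ← finsum_eq_sum_of_fintype]
      exact f.sum_eq_one hr }⟩

theorem surfaceDiv_sum {M : Set E³} {ι : Type*} [Fintype ι] {Z : ι → E³ → E³} {q : E³}
    (hZ : ∀ i, DifferentiableAt ℝ (Z i) q) :
    surfaceDiv M (fun r => ∑ i, Z i r) q = ∑ i, surfaceDiv M (Z i) q := by
  simp only [surfaceDiv]
  rw [fderiv_fun_sum fun i _ => hZ i, ← map_sum]
  congr 1
  ext v
  simp

namespace AdaptedPartition

variable {M C : Set E³} (A : AdaptedPartition M C)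

theorem sum_eq_one {q : E³} (hq : q ∈ M) : ∑ i, A.χ i q = 1 :=
  (A.sum_eventually_eq_one q hq).self_of_nhds

theorem eq_zero_of_notMem (i : A.ι) {q : E³} (hq : q ∉ A.O i) : A.χ i q = 0 :=
  image_eq_zero_of_notMem_tsupport fun h => hq (A.tsupport_subset i h)

/-- The parameters of the support of a function of the partition of unity. -/
def K (i : A.ι) : Set E² := A.φ i '' (M ∩ tsupport (A.χ i))

theorem isCompact_K (hM : IsCompact M) (i : A.ι) : IsCompact (A.K i) :=
  (hM.inter_right (isClosed_tsupport _)).image_of_continuousOn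
    ((A.isLocalInverse i).contDiffOn.continuousOn.mono
      (inter_subset_right.trans (A.tsupport_subset i)))

theorem K_subset (i : A.ι) : A.K i ⊆ (A.chart i).U := by
  rintro _ ⟨q, hq, rfl⟩
  exact (A.isLocalInverse i).mapsTo (A.tsupport_subset i hq.2)

theorem inter_tsupport_subset (i : A.ι) : M ∩ tsupport (A.χ i) ⊆ (A.chart i).S '' A.K i :=
  fun q hq => ⟨_, mem_image_of_mem _ hq,
    (A.isLocalInverse i).right_inv q ⟨hq.1, A.tsupport_subset i hq.2⟩⟩

/-- The product of a field with a function of the partition of unity. -/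
def cut (i : A.ι) (Z : E³ → E³) (q : E³) : E³ := A.χ i q • Z q

section Field

variable {Z : E³ → E³}

theorem contDiff_cut (i : A.ι) (hZ : ContDiff ℝ 1 Z) : ContDiff ℝ 1 (A.cut i Z) :=
  (A.contDiff i).smul hZ

theorem cut_mem (i : A.ι) (hT : ∀ q ∈ M, Z q ∈ tangentPlane M q) (q : E³) (hq : q ∈ M) :
    A.cut i Z q ∈ tangentPlane M q :=
  Submodule.smul_mem _ _ (hT q hq)

theorem inter_tsupport_cut_subset (i : A.ι) (Z : E³ → E³) :
    M ∩ tsupport (A.cut i Z) ⊆ (A.chart i).S '' A.K i :=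
  (inter_subset_inter_right M (tsupport_smul_subset_left (A.χ i) Z)).trans
    (A.inter_tsupport_subset i)

theorem surfaceDiv_eq_sum (hZ : ContDiff ℝ 1 Z) {q : E³} (hq : q ∈ M) :
    surfaceDiv M Z q = ∑ i, surfaceDiv M (A.cut i Z) q := by
  rw [← surfaceDiv_sum fun i => (A.contDiff_cut i hZ).differentiable (by simp) q]
  have : Z =ᶠ[𝓝 q] fun r => ∑ i, A.cut i Z r := by
    filter_upwards [A.sum_eventually_eq_one q hq] with r hr
    simp only [cut]
    rw [← Finset.sum_smul, hr, one_smul]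
  simp only [surfaceDiv, this.fderiv_eq]

theorem integrable_surfaceDiv_cut (hM : IsClosedSurface M) (hZ : ContDiff ℝ 1 Z)
    (hT : ∀ q ∈ M, Z q ∈ tangentPlane M q) (i : A.ι) :
    Integrable (surfaceDiv M (A.cut i Z)) (areaMeasure M) :=
  (A.chart i).integrable_surfaceDiv hM.measurableSet (A.contDiff_cut i hZ) (A.cut_mem i hT)
    (A.isCompact_K hM.isCompact i) (A.inter_tsupport_cut_subset i Z) (A.K_subset i)

theorem integrable_surfaceDiv (A : AdaptedPartition M C) (hM : IsClosedSurface M)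
    (hZ : ContDiff ℝ 1 Z) (hT : ∀ q ∈ M, Z q ∈ tangentPlane M q) :
    Integrable (surfaceDiv M Z) (areaMeasure M) := by
  refine (integrable_finsetSum Finset.univ
    fun i _ => A.integrable_surfaceDiv_cut hM hZ hT i).congr ?_
  filter_upwards [ae_mem_areaMeasure hM.measurableSet] with q hq
  rw [A.surfaceDiv_eq_sum hZ hq]

/-- **Gauss–Green formula** on `C`, the boundary integral being localized by the partition of
unity. -/
theorem integral_indicator_mul_surfaceDiv (hM : IsClosedSurface M)
    (hC : NullMeasurableSet C (areaMeasure M)) (hZ : ContDiff ℝ 1 Z)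
    (hT : ∀ q ∈ M, Z q ∈ tangentPlane M q) :
    ∫ q, C.indicator 1 q * surfaceDiv M Z q ∂areaMeasure M
      = ∑ i, -∫ s, (A.chart i).U.indicator (fun x => A.χ i ((A.chart i).S x) *
          inner ℝ (Z ((A.chart i).S x)) ((A.chart i).conormal x) * ‖(A.chart i).coordVec 0 x‖)
          (planePoint (s, 0)) := by
  have h1 : ∫ q, C.indicator 1 q * surfaceDiv M Z q ∂areaMeasure M
      = ∫ q, ∑ i, C.indicator 1 q * surfaceDiv M (A.cut i Z) q ∂areaMeasure M := by
    refine integral_congr_ae ?_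
    filter_upwards [ae_mem_areaMeasure hM.measurableSet] with q hq
    rw [A.surfaceDiv_eq_sum hZ hq, Finset.mul_sum]
  rw [h1, integral_finsetSum]
  · refine Finset.sum_congr rfl fun i _ => ?_
    rw [(A.chart i).integral_indicator_mul_surfaceDiv (A.isAdapted i) hM.measurableSet
      (A.contDiff_cut i hZ) (A.cut_mem i hT) (A.isCompact_K hM.isCompact i)
      (A.inter_tsupport_cut_subset i Z) (A.K_subset i)]
    simp only [cut, real_inner_smul_left]
  · intro i _
    refine ((A.integrable_surfaceDiv_cut hM hZ hT i).indicator₀ hC).congr (ae_of_all _ fun q => ?_)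
    by_cases hq : q ∈ C <;> simp [hq]

end Field

theorem continuous (i : A.ι) : Continuous (A.χ i) := (A.contDiff i).continuous

theorem integrable_line (hM : IsCompact M) (i : A.ι) :
    Integrable fun s => (A.chart i).U.indicator
      (fun x => A.χ i ((A.chart i).S x) * ‖(A.chart i).coordVec 0 x‖) (planePoint (s, 0)) := by
  set P := A.chart i
  have hK : IsCompact ((fun s => planePoint (s, 0)) ⁻¹' A.K i) :=
    (isometry_planePoint_fst 0).isClosedEmbedding.isCompact_preimage (A.isCompact_K hM i)
  have hc : ContinuousOn (fun x => A.χ i (P.S x) * ‖P.coordVec 0 x‖) P.U :=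
    ((A.continuous i).comp_continuousOn P.continuousOn).mul
      (P.contDiffOn_coordVec 0).continuousOn.norm
  have hcK : ContinuousOn (fun s => P.U.indicator
      (fun x => A.χ i (P.S x) * ‖P.coordVec 0 x‖) (planePoint (s, 0)))
      ((fun s => planePoint (s, 0)) ⁻¹' A.K i) := by
    refine ContinuousOn.congr (f := fun s => (fun x => A.χ i (P.S x) * ‖P.coordVec 0 x‖)
      (planePoint (s, 0))) (hc.comp (isometry_planePoint_fst 0).continuous.continuousOn
        fun s hs => A.K_subset i hs) fun s hs => ?_
    exact indicator_of_mem (A.K_subset i hs) _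
  refine (integrableOn_iff_integrable_of_support_subset fun s hs => ?_).1
    (hcK.integrableOn_compact hK)
  by_contra hsK
  refine hs ?_
  by_cases hU : planePoint (s, 0) ∈ P.U
  · simp only [indicator_of_mem hU]
    have : A.χ i (P.S (planePoint (s, 0))) = 0 := by
      refine image_eq_zero_of_notMem_tsupport fun h => hsK ?_
      obtain ⟨y, hy, hyx⟩ := A.inter_tsupport_subset i ⟨P.mem hU, h⟩
      rw [mem_preimage, ← P.injOn (A.K_subset i hy) hU hyx]
      exact hy
    rw [this, zero_mul]
  · exact indicator_of_notMem hU _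

/-- The perimeter, computed in the parametrizations. -/
theorem sum_integral_line (hM : IsClosedSurface M) (hCM : C ⊆ M) (Γ : BoundaryParam M C) :
    ∑ i, ∫ s, (A.chart i).U.indicator
      (fun x => A.χ i ((A.chart i).S x) * ‖(A.chart i).coordVec 0 x‖) (planePoint (s, 0))
      = Γ.per := by
  have hcl := hM.isCompact.isClosed
  simp only [fun i => Γ.integral_line_eq_sum hcl hCM (A.isAdapted i) (A.isLocalInverse i)
    (A.continuous i) fun q hq => A.eq_zero_of_notMem i hq]
  rw [Finset.sum_comm, BoundaryParam.per]
  refine Finset.sum_congr rfl fun j _ => ?_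
  simp only [Γ.intervalIntegral_eq]
  rw [← integral_finsetSum _ fun i _ => Γ.integrableOn_mul_norm_deriv (A.continuous i) j]
  refine setIntegral_congr_fun measurableSet_Ioo fun t ht => ?_
  rw [← Finset.sum_mul, A.sum_eq_one (relBoundary_subset hcl hCM
    (Γ.mem_relBoundary (Ioo_subset_Ico_self ht))), one_mul]

/-- The outer conormals of the adapted parametrizations, glued by the partition of unity. -/
def outerConormal (q : E³) : E³ := ∑ i, A.χ i q • -(A.chart i).conormal (A.φ i q)

theorem isTestField_outerConormal : IsTestField M A.outerConormal where
  contDiff := by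
    refine ContDiff.sum fun i _ => contDiff_iff_contDiffAt.2 fun q => ?_
    by_cases hq : q ∈ tsupport (A.χ i)
    swap
    · refine (contDiffAt_const (c := 0)).congr_of_eventuallyEq ?_
      filter_upwards [notMem_tsupport_iff_eventuallyEq.1 hq] with r hr
      simp [hr]
    have hqO : q ∈ A.O i := A.tsupport_subset i hq
    set P := A.chart i
    have hφ := A.isLocalInverse i
    have hNφ : ContDiffAt ℝ 1 (fun q => P.conormal (A.φ i q)) q :=
      (P.contDiffOn_conormal.comp hφ.contDiffOn hφ.mapsTo).contDiffAt (hφ.isOpen.mem_nhds hqO)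
    have hχ : ContDiffAt ℝ 1 (A.χ i) q := (A.contDiff i).contDiffAt
    exact hχ.smul hNφ.neg
  tangent := fun q hq => by
    refine Submodule.sum_mem _ fun i _ => ?_
    by_cases hqO : q ∈ A.O i
    · refine Submodule.smul_mem _ _ (Submodule.neg_mem _ ?_)
      have h := (A.chart i).tangentPlane_eq ((A.isLocalInverse i).mapsTo hqO)
      rw [(A.isLocalInverse i).right_inv q ⟨hq, hqO⟩] at h
      rw [h]
      exact gramNormal_mem_span _ _
    · rw [A.eq_zero_of_notMem i hqO, zero_smul]
      exact Submodule.zero_mem _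
  norm_le_one := fun q hq => by
    refine (norm_sum_le _ _).trans ((Finset.sum_le_sum fun i _ => ?_).trans (A.sum_eq_one hq).le)
    by_cases hqO : q ∈ A.O i
    · have hx := (A.isLocalInverse i).mapsTo hqO
      rw [norm_smul, norm_neg, LocalParam.conormal,
        norm_gramNormal ((A.chart i).coordVec_ne_zero hx 0) ((A.chart i).gram_pos hx), mul_one,
        Real.norm_of_nonneg (A.nonneg i q)]
    · simp [A.eq_zero_of_notMem i hqO]

/-- On the boundary the glued field is minus the common inner conormal of the parametrizations. -/
theorem inner_outerConormal (hCM : C ⊆ M) (i : A.ι) {x : E²} (hx : x ∈ (A.chart i).U)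
    (hx1 : x 1 = 0) :
    inner ℝ (A.outerConormal ((A.chart i).S x)) ((A.chart i).conormal x) = -1 := by
  have hq := (A.chart i).mem hx
  rw [outerConormal, sum_inner, ← A.sum_eq_one hq, ← Finset.sum_neg_distrib]
  refine Finset.sum_congr rfl fun j _ => ?_
  by_cases hqO : (A.chart i).S x ∈ A.O j
  · rw [(A.isAdapted j).conormal_eq hCM (A.isAdapted i) hx ((A.isLocalInverse j).mapsTo hqO)
      ((A.isLocalInverse j).right_inv _ ⟨hq, hqO⟩) hx1, real_inner_smul_left, inner_neg_left,
      real_inner_self_eq_norm_sq, LocalParam.conormal,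
      norm_gramNormal ((A.chart i).coordVec_ne_zero hx 0) ((A.chart i).gram_pos hx)]
    ring
  · simp [A.eq_zero_of_notMem j hqO]

theorem integral_outerConormal (hM : IsClosedSurface M) (hCM : C ⊆ M)
    (hC : NullMeasurableSet C (areaMeasure M)) (Γ : BoundaryParam M C) :
    ∫ q, C.indicator 1 q * surfaceDiv M A.outerConormal q ∂areaMeasure M = Γ.per := by
  rw [A.integral_indicator_mul_surfaceDiv hM hC A.isTestField_outerConormal.contDiff
    A.isTestField_outerConormal.tangent, ← A.sum_integral_line hM hCM Γ]
  refine Finset.sum_congr rfl fun i _ => ?_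
  rw [← integral_neg]
  refine integral_congr_ae (ae_of_all _ fun s => ?_)
  by_cases hU : planePoint (s, 0) ∈ (A.chart i).U
  · simp only [indicator_of_mem hU]
    rw [A.inner_outerConormal hCM i hU rfl]
    ring
  · simp [indicator_of_notMem hU]

theorem integral_le_per (A : AdaptedPartition M C) (hM : IsClosedSurface M) (hCM : C ⊆ M)
    (hC : NullMeasurableSet C (areaMeasure M)) (Γ : BoundaryParam M C) {Z : E³ → E³}
    (hZ : IsTestField M Z) :
    ∫ q, C.indicator 1 q * surfaceDiv M Z q ∂areaMeasure M ≤ Γ.per := by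
  rw [A.integral_indicator_mul_surfaceDiv hM hC hZ.contDiff hZ.tangent,
    ← A.sum_integral_line hM hCM Γ]
  refine Finset.sum_le_sum fun i _ => (neg_le_abs _).trans ?_
  rw [← Real.norm_eq_abs]
  refine norm_integral_le_of_norm_le (A.integrable_line hM.isCompact i) (ae_of_all _ fun s => ?_)
  by_cases hU : planePoint (s, 0) ∈ (A.chart i).U
  · simp only [indicator_of_mem hU]
    rw [norm_mul, norm_norm, norm_mul, Real.norm_of_nonneg (A.nonneg i _)]
    refine mul_le_mul_of_nonneg_right (mul_le_of_le_one_right (A.nonneg i _) ?_) (norm_nonneg _)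
    refine (norm_inner_le_norm _ _).trans ?_
    rw [LocalParam.conormal, norm_gramNormal ((A.chart i).coordVec_ne_zero hU 0)
      ((A.chart i).gram_pos hU), mul_one]
    exact hZ.norm_le_one _ ((A.chart i).mem hU)
  · simp [indicator_of_notMem hU]

end AdaptedPartition

/-- The **divergence theorem** on a closed surface: the Gauss–Green formula for `C = M`, which has
no boundary. -/
theorem IsClosedSurface.integral_surfaceDiv {M : Set E³} (hM : IsClosedSurface M) {Z : E³ → E³}
    (hZ : ContDiff ℝ 1 Z) (hT : ∀ q ∈ M, Z q ∈ tangentPlane M q) :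
    ∫ q, surfaceDiv M Z q ∂areaMeasure M = 0 := by
  have hempty : relBoundary M M = ∅ := by simp [relBoundary]
  obtain ⟨A⟩ := exists_adaptedPartition (C := M) hM (by simp [HasSmoothBoundary, hempty])
  have h1 : ∫ q, surfaceDiv M Z q ∂areaMeasure M
      = ∫ q, M.indicator 1 q * surfaceDiv M Z q ∂areaMeasure M := by
    refine integral_congr_ae ?_
    filter_upwards [ae_mem_areaMeasure hM.measurableSet] with q hq
    simp [hq]
  rw [h1, A.integral_indicator_mul_surfaceDiv hM hM.measurableSet.nullMeasurableSet hZ hT]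
  refine Finset.sum_eq_zero fun i _ => neg_eq_zero.2 ?_
  refine integral_eq_zero_of_ae (ae_of_all _ fun s => ?_)
  refine indicator_of_notMem (fun hU => ?_) _
  have := ((A.isAdapted i).mem_relBoundary_iff subset_rfl hU).2 rfl
  simp [hempty] at this

/-! ### Total variation and eigenvalue -/

theorem NETV_eq_of_forall_le_of_exists {M : Set E³} {u : E³ → ℝ} {r : ℝ}
    (hle : ∀ Z, IsTestField M Z → ∫ q, u q * surfaceDiv M Z q ∂areaMeasure M ≤ r)
    (hex : ∃ Z, IsTestField M Z ∧ ∫ q, u q * surfaceDiv M Z q ∂areaMeasure M = r) :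
    NETV M u = (r : EReal) := by
  obtain ⟨Z, hZ, h⟩ := hex
  refine le_antisymm (iSup₂_le fun Z hZ => EReal.coe_le_coe_iff.2 (hle Z hZ)) ?_
  exact le_iSup₂_of_le Z hZ (EReal.coe_le_coe_iff.2 h.ge)

theorem areaMeasure_pos {M C : Set E³} (hM : IsClosedSurface M) (hCM : C ⊆ M) (hC : C.Nonempty)
    (hbd : HasSmoothBoundary M C) : 0 < areaMeasure M C := by
  obtain ⟨p, hp⟩ := hC
  obtain ⟨P, ⟨x, hx, rfl⟩, hP⟩ := LocalParam.exists_isAdapted hM hbd (hCM hp)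
  have hx1 : 0 ≤ x 1 := by
    by_contra h
    exact (hP x hx).2 (not_le.1 h) hp
  have hW : IsOpen (P.U ∩ {y | 0 < y 1}) :=
    P.isOpen_U.inter (isOpen_lt continuous_const (by fun_prop))
  have hne : (P.U ∩ {y | 0 < y 1}).Nonempty := by
    obtain ⟨t, ht, ht0⟩ := (((P.eventually_mem_line hx (EuclideanSpace.single 1 1)).filter_mono
      (nhdsWithin_le_nhds (s := Ioi 0))).and self_mem_nhdsWithin).exists
    refine ⟨_, ht, ?_⟩
    have ht0' : (0 : ℝ) < t := ht0
    simpa using add_pos_of_nonneg_of_pos hx1 ht0'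
  have hsub : P.S '' (P.U ∩ {y | 0 < y 1}) ⊆ C := by
    rintro _ ⟨y, hy, rfl⟩
    exact (hP y hy.1).1 hy.2
  refine lt_of_lt_of_le ?_ (measure_mono hsub)
  rw [P.areaMeasure_image hW.measurableSet inter_subset_left,
    setLIntegral_pos_iff P.measurable_density]
  refine (hW.measure_pos volume hne).trans_le (measure_mono fun y hy => ⟨?_, hy⟩)
  simpa using P.gram_pos hy.1

theorem mainTheorem4 (M C : Set (EuclideanSpace ℝ (Fin 3))) (hM : IsClosedSurface M)
    (hCM : C ⊆ M) (hC : C.Nonempty) (hbd : HasSmoothBoundary M C) (Γ : BoundaryParam M C)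
    (lam : ℝ) (heig : IsEigenset M C lam) :
    ((lam * (areaMeasure M).real C : ℝ) : EReal) = NETV M (C.indicator 1) ∧
    NETV M (C.indicator 1) = ((Γ.per : ℝ) : EReal) ∧
    0 < (areaMeasure M).real C ∧
    lam = Γ.per / (areaMeasure M).real C := by
  have hfin := hM.isFiniteMeasure
  have haeM := ae_mem_areaMeasure hM.measurableSet
  obtain ⟨β, hβ, hψL, ξ, ⟨-, -, hsub⟩, hdiv⟩ := heig
  set ψ : E³ → ℝ := fun q => C.indicator 1 q - β * (M \ C).indicator 1 q with hψ
  have hψC : ∀ q ∈ C, ψ q = 1 := fun q hq => by simp [hψ, hq]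
  have hψM : ∀ q ∈ M, q ∉ C → ψ q = -β := fun q hqM hq => by simp [hψ, hq, hqM]
  -- `C` is the set of positivity of `ψ`, which is measurable up to a null set.
  have hCm : NullMeasurableSet C (areaMeasure M) := by
    have : C = ψ ⁻¹' Ioi 0 := by
      ext q
      constructor
      · intro hq
        simp [hψC q hq]
      · intro hq
        by_contra hqC
        have h0 : (0 : ℝ) < ψ q := hq
        by_cases hqM : q ∈ M
        · rw [hψM q hqM hqC] at h0
          linarith
        · simp [hψ, hqC, hqM] at h0
    rw [this]
    exact hψL.aestronglyMeasurable.aemeasurable.nullMeasurable measurableSet_Ioi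
  obtain ⟨A⟩ := exists_adaptedPartition hM hbd
  have hper : NETV M (C.indicator 1) = ((Γ.per : ℝ) : EReal) :=
    NETV_eq_of_forall_le_of_exists (fun Z hZ => A.integral_le_per hM hCM hCm Γ hZ)
      ⟨_, A.isTestField_outerConormal, A.integral_outerConormal hM hCM hCm Γ⟩
  -- Constants do not contribute to the total variation, whence `NETV ψ = (1 + β) NETV C`.
  have hscale : ∀ Z, IsTestField M Z → ∫ q, ψ q * surfaceDiv M Z q ∂areaMeasure M
      = (1 + β) * ∫ q, C.indicator 1 q * surfaceDiv M Z q ∂areaMeasure M := by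
    intro Z hZ
    have hint := A.integrable_surfaceDiv hM hZ.contDiff hZ.tangent
    have hintC : Integrable (fun q => C.indicator 1 q * surfaceDiv M Z q) (areaMeasure M) := by
      refine (hint.indicator₀ hCm).congr (ae_of_all _ fun q => ?_)
      by_cases hq : q ∈ C <;> simp [hq]
    have h1 : ∫ q, ψ q * surfaceDiv M Z q ∂areaMeasure M
        = ∫ q, ((1 + β) * (C.indicator 1 q * surfaceDiv M Z q) - β * surfaceDiv M Z q)
          ∂areaMeasure M := by
      refine integral_congr_ae ?_
      filter_upwards [haeM] with q hqM
      by_cases hq : q ∈ C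
      · simp only [hψC q hq, indicator_of_mem hq, Pi.one_apply]
        ring
      · simp only [hψM q hqM hq, indicator_of_notMem hq]
        ring
    rw [h1, integral_sub (hintC.const_mul _) (hint.const_mul _), integral_const_mul,
      integral_const_mul, hM.integral_surfaceDiv hZ.contDiff hZ.tangent, mul_zero, sub_zero]
  have hNψ : NETV M ψ = (((1 + β) * Γ.per : ℝ) : EReal) := by
    refine NETV_eq_of_forall_le_of_exists (fun Z hZ => ?_) ⟨_, A.isTestField_outerConormal, ?_⟩
    · rw [hscale Z hZ]
      exact mul_le_mul_of_nonneg_left (A.integral_le_per hM hCM hCm Γ hZ) (by linarith)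
    · rw [hscale _ A.isTestField_outerConormal, A.integral_outerConormal hM hCM hCm Γ]
  -- Testing the weak divergence with a constant shows that `lam * ψ` has mean zero.
  have hmean : ∫ q, lam * ψ q ∂areaMeasure M = 0 := by
    simpa using hdiv.integral_eq (fun _ => 1) contDiff_const
  have hCint : Integrable (C.indicator (1 : E³ → ℝ)) (areaMeasure M) :=
    (integrable_const (1 : ℝ)).indicator₀ hCm
  have hCval : ∫ q, C.indicator (1 : E³ → ℝ) q ∂areaMeasure M = (areaMeasure M).real C := by
    rw [integral_indicator₀ hCm]
    simp [Measure.real]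
  have hpair : ∫ q, lam * ψ q * ψ q ∂areaMeasure M
      = (1 + β) * (lam * (areaMeasure M).real C) := by
    have h1 : ∫ q, lam * ψ q * ψ q ∂areaMeasure M
        = ∫ q, ((1 + β) * lam * C.indicator 1 q - β * (lam * ψ q)) ∂areaMeasure M := by
      refine integral_congr_ae ?_
      filter_upwards [haeM] with q hqM
      by_cases hq : q ∈ C
      · simp only [hψC q hq, indicator_of_mem hq, Pi.one_apply]
        ring
      · simp only [hψM q hqM hq, indicator_of_notMem hq]
        ring
    rw [h1, integral_sub (hCint.const_mul _) (hdiv.integrable_div.const_mul _),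
      integral_const_mul, integral_const_mul, hmean, hCval]
    ring
  have hlam : lam * (areaMeasure M).real C = Γ.per := by
    rw [hNψ, EReal.coe_eq_coe_iff, hpair] at hsub
    exact (mul_left_cancel₀ (by linarith : 1 + β ≠ 0) hsub).symm
  have hpos : 0 < (areaMeasure M).real C :=
    ENNReal.toReal_pos (areaMeasure_pos hM hCM hC hbd).ne' (measure_ne_top _ _)
  refine ⟨by rw [hper, hlam], hper, hpos, ?_⟩
  rw [← hlam, mul_div_cancel_right₀ _ hpos.ne']

end
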